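/- Let $k$ be an algebraically closed field of characteristic $p\ge 3$ and let $\mathfrak g=\mathfrak g_{\bar 0}\oplus\mathfrak g_{\bar 1}$ be a finite-dimensional Lie superalgebra over $k$ (if $p=3$, the definition includes $[x,[x,x]]=0$ for $x\in\mathfrak g_{\bar 1}$). Let $\Lambda_s(\mathfrak g^*)$ be the superexterior algebra, i.e. the quotient of the tensor algebra of $\mathfrak g^*$ by the relations $fg=-(-1)^{\bar f\,\bar g}gf$ for homogeneous $f,g\in\mathfrak g^*$, and let $\partial$ be the Koszul differential: the derivation, $\partial(ab)=\partial(a)b+(-1)^{\deg a}a\,\partial(b)$, whose restriction $\mathfrak g^*\to\Lambda^2_s(\mathfrak g^*)\cong\Lambda^2_s(\mathfrak g)^*$ is the transpose of the Lie bracket. Let $H^\bullet(\mathfrak g,k)$ be the cohomology ring of $(\Lambda_s(\mathfrak g^*),\partial)$. Its nilpotent elements form an ideal $\mathrm{Nil}$ with commutative quotient, and $\mathrm{Max}(H^\bullet(\mathfrak g,k))$ denotes the maximal ideal spectrum of $H^\bullet(\mathfrak g,k)/\mathrm{Nil}$ with the Zariski topology. The $p$-power map $z\mapsto z^p$ from $S(\mathfrak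 g_{\bar 1}^*)$ to $S(\mathfrak g_{\bar 1}^*)\subseteq\Lambda_s(\mathfrak g^*)$ takes values in cocycles and induces a ring homomorphism $\varphi: S(\mathfrak g_{\bar 1}^*[p])^{(1)}\to H^\bullet(\mathfrak g,k)$; here the shift $[p]$ and the Frobenius twist $(1)$ change only the grading and the $k$-linear structure, not the ring $S(\mathfrak g_{\bar 1}^*)$. Let $J=\varphi^{-1}(I)$, where $I$ is the annihilator of $H^\bullet(\mathfrak g,k)$ acting on itself by left multiplication, and set $\mathcal X_{\mathfrak g}(k)=\mathrm{Max}\bigl(S(\mathfrak g_{\bar 1}^*[p])^{(1)}/J\bigr)$, with the Zariski topology. For $x\in\mathfrak g_{\bar 1}$ let $\mathfrak m_x\subset S(\mathfrak g_{\bar 1}^*)$ be the ideal of polynomial functions vanishing at $x$, and let $C=\{x\in\mathfrak g_{\bar 1}:[x,x]=0\}$ with the subspace topology of the Zariski topology of $\mathfrak g_{\bar 1}$. Then: 1. $\mathcal X_{\mathfrak g}(k)\cong C$: there is a homeomorphism $C\to\mathcal X_{\mathfrak g}(k)$ sending each $x\in C$ to the maximal ideal whose preimage in $S(\mathfrak g_{\bar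 1}^*)$ is $\mathfrak m_x$ (so that $\mathcal X_{\mathfrak g}(k)$, as a closed subset of $\mathrm{Max}(S(\mathfrak g_{\bar 1}^*))=\mathfrak g_{\bar 1}$, is $C$), and the radical of $J$ is the ideal of all polynomial functions on $\mathfrak g_{\bar 1}$ that vanish on $C$. 2. There is a homeomorphism $C\to\mathrm{Max}(H^\bullet(\mathfrak g,k))$ sending each $x\in C$ to the maximal ideal whose preimage under $S(\mathfrak g_{\bar 1}^*)\xrightarrow{\varphi}H^\bullet(\mathfrak g,k)\to H^\bullet(\mathfrak g,k)/\mathrm{Nil}$ is $\mathfrak m_x$. In particular $\varphi$ induces a homeomorphism $\mathrm{Max}(H^\bullet(\mathfrak g,k))\cong\mathcal X_{\mathfrak g}(k)$. -/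

import Mathlib

set_option linter.unusedSectionVars false
open TensorProduct Module

noncomputable section

universe u v

/-! ### Lie superalgebras -/

/-- The sign `(-1)^(i * j)` for parities `i`, `j` in `ℤ/2`. -/
def superSign (i j : ZMod 2) : ℤ := if i = 1 ∧ j = 1 then -1 else 1

/-- The structure of a Lie superalgebra on the superspace `𝔤 = 𝒢 0 ⊕ 𝒢 1`.  The last axiom follows
from the super Jacobi identity when `3` is invertible and is part of the usual definition in
characteristic `3`. -/
structure LieSuperalgebra (k : Type u) {𝔤 : Type v} [Field k] [AddCommGroup 𝔤] [Module k 𝔤]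
    (𝒢 : ZMod 2 → Submodule k 𝔤) [DirectSum.Decomposition 𝒢] where
  /-- the Lie bracket -/
  bracket : 𝔤 →ₗ[k] 𝔤 →ₗ[k] 𝔤
  bracket_mem : ∀ i j x y, x ∈ 𝒢 i → y ∈ 𝒢 j → bracket x y ∈ 𝒢 (i + j)
  bracket_skew : ∀ i j x y, x ∈ 𝒢 i → y ∈ 𝒢 j →
    bracket x y = -(superSign i j • bracket y x)
  jacobi : ∀ i j l x y z, x ∈ 𝒢 i → y ∈ 𝒢 j → z ∈ 𝒢 l →
    bracket x (bracket y z) =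
      bracket (bracket x y) z + superSign i j • bracket y (bracket x z)
  bracket_odd_cube : ∀ x, x ∈ 𝒢 1 → bracket x (bracket x x) = 0

/-! ### Superspaces, their duals, and the superexterior algebra -/

section Super

variable {k : Type u} {V : Type v} [Field k] [AddCommGroup V] [Module k V]

/-- The homogeneous subspaces of the dual `V^*` of a superspace `V`: the functionals of parity `i`
are those which vanish on all homogeneous vectors of parity different from `i`. -/
def dualPart (𝒱 : ZMod 2 → Submodule k V) (i : ZMod 2) : Submodule k (Dual k V) where
  carrier := {f | ∀ j, j ≠ i → ∀ x ∈ 𝒱 j, f x = 0}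
  add_mem' := by
    intro f g hf hg j hj x hx
    simp [hf j hj x hx, hg j hj x hx]
  zero_mem' := by
    intro j hj x hx
    simp
  smul_mem' := by
    intro c f hf j hj x hx
    simp [hf j hj x hx]

/-- The projection of a superspace onto its subspace of parity `i`. -/
def superProj (𝒱 : ZMod 2 → Submodule k V) [DirectSum.Decomposition 𝒱] (i : ZMod 2) :
    V →ₗ[k] 𝒱 i :=
  DirectSum.component k (ZMod 2) (fun j => 𝒱 j) i ∘ₗ
    (DirectSum.decomposeLinearEquiv 𝒱).toLinearMap

/-- The defining relations `v w = -(-1)^(|v||w|) w v`, for homogeneous `v` and `w`, of the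
superexterior algebra. -/
inductive SuperExteriorRel (𝒱 : ZMod 2 → Submodule k V) :
    TensorAlgebra k V → TensorAlgebra k V → Prop
  | swap (i j : ZMod 2) (v w : V) (hv : v ∈ 𝒱 i) (hw : w ∈ 𝒱 j) :
      SuperExteriorRel 𝒱 (TensorAlgebra.ι k v * TensorAlgebra.ι k w)
        (-(superSign i j • (TensorAlgebra.ι k w * TensorAlgebra.ι k v)))

/-- The superexterior algebra `Λ_s(V)` of a superspace `V` (in characteristic different from `2`):
the free graded-commutative graded superalgebra on `V` placed in degree `1`. -/
def SuperExterior (𝒱 : ZMod 2 → Submodule k V) := (ringConGen (SuperExteriorRel 𝒱)).Quotient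

namespace SuperExterior

variable (𝒱 : ZMod 2 → Submodule k V)

instance instRing : Ring (SuperExterior 𝒱) :=
  inferInstanceAs (Ring (ringConGen (SuperExteriorRel 𝒱)).Quotient)

instance instAlgebra : Algebra k (SuperExterior 𝒱) :=
  inferInstanceAs (Algebra k (ringConGen (SuperExteriorRel 𝒱)).Quotient)

/-- The quotient map `T(V) → Λ_s(V)`. -/
def mk : TensorAlgebra k V →ₐ[k] SuperExterior 𝒱 :=
  RingCon.mkₐ k (ringConGen (SuperExteriorRel 𝒱))

theorem mk_surjective : Function.Surjective (mk 𝒱) :=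
  Quotient.mk_surjective

/-- The inclusion of the generators `V ⊆ Λ_s(V)`. -/
def gen : V →ₗ[k] SuperExterior 𝒱 :=
  (mk 𝒱).toLinearMap ∘ₗ TensorAlgebra.ι k

variable {𝒱}

theorem gen_swap {i j : ZMod 2} {v w : V} (hv : v ∈ 𝒱 i) (hw : w ∈ 𝒱 j) :
    gen 𝒱 v * gen 𝒱 w = -(superSign i j • (gen 𝒱 w * gen 𝒱 v)) := by
  have h : mk 𝒱 (TensorAlgebra.ι k v * TensorAlgebra.ι k w) =
      mk 𝒱 (-(superSign i j • (TensorAlgebra.ι k w * TensorAlgebra.ι k v))) :=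
    Quotient.sound (RingCon.le_ringConGen _ _ (SuperExteriorRel.swap i j v w hv hw))
  rw [map_mul, map_neg, map_zsmul, map_mul] at h
  exact h

/-- The universal property of the superexterior algebra. -/
def lift {A : Type*} [Ring A] [Algebra k A] (f : V →ₗ[k] A)
    (hf : ∀ i j v w, v ∈ 𝒱 i → w ∈ 𝒱 j → f v * f w = -(superSign i j • (f w * f v))) :
    SuperExterior 𝒱 →ₐ[k] A :=
  RingCon.liftₐ (ringConGen (SuperExteriorRel 𝒱)) (TensorAlgebra.lift k f) (by
    refine RingCon.ringConGen_le.2 fun x y h => ?_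
    obtain ⟨i, j, v, w, hv, hw⟩ := h
    simpa [-zsmul_eq_mul] using hf i j v w hv hw)

@[simp]
theorem lift_gen {A : Type*} [Ring A] [Algebra k A] (f : V →ₗ[k] A)
    (hf : ∀ i j v w, v ∈ 𝒱 i → w ∈ 𝒱 j → f v * f w = -(superSign i j • (f w * f v))) (v : V) :
    lift f hf (gen 𝒱 v) = f v := by
  exact (RingCon.liftₐ_mk _ _ _ _).trans (TensorAlgebra.lift_ι_apply _ v)

theorem induction {motive : SuperExterior 𝒱 → Prop}
    (scalar : ∀ c : k, motive (algebraMap k _ c)) (gen : ∀ v, motive (gen 𝒱 v))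
    (mul : ∀ a b, motive a → motive b → motive (a * b))
    (sum : ∀ a b, motive a → motive b → motive (a + b)) (a : SuperExterior 𝒱) : motive a := by
  obtain ⟨t, rfl⟩ := mk_surjective 𝒱 a
  induction t using TensorAlgebra.induction with
  | algebraMap r => rw [AlgHom.commutes]; exact scalar r
  | ι x => exact gen x
  | mul x y hx hy => rw [map_mul]; exact mul _ _ hx hy
  | add x y hx hy => rw [map_add]; exact sum _ _ hx hy

end SuperExterior

end Super

/-! ### The Koszul complex with trivial coefficients -/

namespace LieSuperalgebra

variable {k : Type u} {𝔤 : Type v} [Field k] [AddCommGroup 𝔤] [Module k 𝔤]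
  {𝒢 : ZMod 2 → Submodule k 𝔤} [DirectSum.Decomposition 𝒢]

/-- The algebra of cochains `C(𝔤, k) = Λ_s(𝔤^*)`. -/
abbrev Cochains (_L : LieSuperalgebra k 𝒢) := SuperExterior (dualPart 𝒢)

variable (L : LieSuperalgebra k 𝒢)

/-- For `f ∈ 𝔤^*`, the bilinear form `z₁ ⊗ z₂ ↦ f([z₂, z₁])` on `𝔤`. -/
def bracketForm : Dual k 𝔤 →ₗ[k] Dual k (𝔤 ⊗[k] 𝔤) :=
  (TensorProduct.lift L.bracket.flip).dualMap

/-- Multiplication `𝔤^* ⊗ 𝔤^* → Λ_s²(𝔤^*)`. -/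
def mulGen : Dual k 𝔤 ⊗[k] Dual k 𝔤 →ₗ[k] L.Cochains :=
  LinearMap.mul' k L.Cochains ∘ₗ
    TensorProduct.map (SuperExterior.gen (dualPart 𝒢)) (SuperExterior.gen (dualPart 𝒢))

@[simp]
theorem mulGen_tmul (f g : Dual k 𝔤) :
    L.mulGen (f ⊗ₜ g) = SuperExterior.gen _ f * SuperExterior.gen _ g := by
  simp [mulGen]

variable [FiniteDimensional k 𝔤]

/-- The Koszul differential on the generators, `𝔤^* → Λ_s²(𝔤^*)`: the transpose of the Lie bracket.
If `(e_i)` is any basis of `𝔤` with dual basis `(e_i^*)`, then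
`∂f = -(1/2) ∑_{i,j} f([e_j, e_i]) e_i^* e_j^*`; if the `e_i` are homogeneous, then this is
`(1/2) ∑_{i,j} (-1)^(|e_i||e_j|) f([e_i, e_j]) e_i^* e_j^*`.  Thus `∂f`, paired with `z₁ ∧ z₂`
according to the sign rule, is `f([z₁, z₂])`. -/
def dGen : Dual k 𝔤 →ₗ[k] L.Cochains :=
  (-(2 : k)⁻¹) •
    (L.mulGen ∘ₗ (TensorProduct.dualDistribEquiv k 𝔤 𝔤).symm.toLinearMap ∘ₗ L.bracketForm)

end LieSuperalgebra

section Parts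

variable {k : Type u} {V : Type v} [Field k] [AddCommGroup V] [Module k V]
  (𝒱 : ZMod 2 → Submodule k V) [DirectSum.Decomposition 𝒱]

/-- The projection onto the subspace of parity `i`, as an endomorphism. -/
def superEndo (i : ZMod 2) : V →ₗ[k] V := (𝒱 i).subtype ∘ₗ superProj 𝒱 i

theorem superEndo_apply (i : ZMod 2) (x : V) :
    superEndo 𝒱 i x = (DirectSum.decompose 𝒱 x i : V) := rfl

theorem superEndo_mem (i : ZMod 2) (x : V) : superEndo 𝒱 i x ∈ 𝒱 i :=
  (superProj 𝒱 i x).2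

theorem superEndo_of_ne {i j : ZMod 2} (h : j ≠ i) {x : V} (hx : x ∈ 𝒱 j) :
    superEndo 𝒱 i x = 0 :=
  DirectSum.decompose_of_mem_ne 𝒱 hx h

theorem superEndo_of_mem {i : ZMod 2} {x : V} (hx : x ∈ 𝒱 i) : superEndo 𝒱 i x = x :=
  DirectSum.decompose_of_mem_same 𝒱 hx

theorem superEndo_sum (x : V) : superEndo 𝒱 0 x + superEndo 𝒱 1 x = x := by
  induction x using DirectSum.Decomposition.inductionOn 𝒱 with
  | zero => simp
  | homogeneous m =>
    rename_i i
    have hi : ∀ i : ZMod 2, i = 0 ∨ i = 1 := by decide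
    obtain rfl | rfl := hi i
    · rw [superEndo_of_mem 𝒱 m.2, superEndo_of_ne 𝒱 (by decide) m.2, add_zero]
    · rw [superEndo_of_mem 𝒱 m.2, superEndo_of_ne 𝒱 (by decide) m.2, zero_add]
  | add x y hx hy =>
    rw [map_add, map_add]
    nth_rewrite 3 [← hx]
    nth_rewrite 3 [← hy]
    abel

theorem comp_superEndo_mem (f : Dual k V) (i : ZMod 2) : f ∘ₗ superEndo 𝒱 i ∈ dualPart 𝒱 i := by
  intro j hj x hx
  simp [superEndo_of_ne 𝒱 hj hx]

theorem superSign_add (a b j : ZMod 2) :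
    superSign (a + b) j = superSign a j * superSign b j := by
  revert a b j; decide

end Parts

namespace LieSuperalgebra

variable {k : Type u} {𝔤 : Type v} [Field k] [AddCommGroup 𝔤] [Module k 𝔤]
  {𝒢 : ZMod 2 → Submodule k 𝔤} [DirectSum.Decomposition 𝒢] (L : LieSuperalgebra k 𝒢)

theorem mulGen_swap (a b j : ZMod 2) (g : Dual k 𝔤) (hg : g ∈ dualPart 𝒢 j)
    (t : Dual k 𝔤 ⊗[k] Dual k 𝔤) :
    L.mulGen (TensorProduct.map (superEndo 𝒢 a).dualMap (superEndo 𝒢 b).dualMap t) *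
        SuperExterior.gen _ g =
      superSign (a + b) j • (SuperExterior.gen _ g *
        L.mulGen (TensorProduct.map (superEndo 𝒢 a).dualMap (superEndo 𝒢 b).dualMap t)) := by
  induction t using TensorProduct.induction_on with
  | zero => simp
  | add x y hx hy => rw [map_add, map_add, add_mul, mul_add, hx, hy, zsmul_add]
  | tmul u w =>
    have hu : (superEndo 𝒢 a).dualMap u ∈ dualPart 𝒢 a := comp_superEndo_mem 𝒢 u a
    have hw : (superEndo 𝒢 b).dualMap w ∈ dualPart 𝒢 b := comp_superEndo_mem 𝒢 w b
    rw [TensorProduct.map_tmul, mulGen_tmul, mul_assoc, SuperExterior.gen_swap hw hg,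
      mul_neg, mul_smul_comm, ← mul_assoc, SuperExterior.gen_swap hu hg, superSign_add,
      mul_smul, neg_mul, smul_mul_assoc, smul_neg, neg_neg, smul_comm, mul_assoc]

variable [FiniteDimensional k 𝔤]

theorem dualDistrib_map (a b : ZMod 2) (t : Dual k 𝔤 ⊗[k] Dual k 𝔤) :
    TensorProduct.dualDistribEquiv k 𝔤 𝔤
        (TensorProduct.map (superEndo 𝒢 a).dualMap (superEndo 𝒢 b).dualMap t) =
      TensorProduct.dualDistribEquiv k 𝔤 𝔤 t ∘ₗ
        TensorProduct.map (superEndo 𝒢 a) (superEndo 𝒢 b) := by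
  induction t using TensorProduct.induction_on with
  | zero => simp
  | add x y hx hy => rw [map_add, map_add, map_add, hx, hy, LinearMap.add_comp]
  | tmul u w =>
    ext x y
    simp [TensorProduct.dualDistribEquiv, TensorProduct.dualDistribEquivOfBasis]

theorem bracketForm_parts {i : ZMod 2} {f : Dual k 𝔤} (hf : f ∈ dualPart 𝒢 i) {a b : ZMod 2}
    (hab : a + b ≠ i) :
    TensorProduct.map (superEndo 𝒢 a).dualMap (superEndo 𝒢 b).dualMap
      ((TensorProduct.dualDistribEquiv k 𝔤 𝔤).symm (L.bracketForm f)) = 0 := by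
  apply (TensorProduct.dualDistribEquiv k 𝔤 𝔤).injective
  rw [dualDistrib_map, LinearEquiv.apply_symm_apply, map_zero]
  ext x y
  have h := L.bracket_mem b a _ _ (superEndo_mem 𝒢 b y) (superEndo_mem 𝒢 a x)
  simpa [bracketForm] using hf _ (by rwa [add_comm]) _ h

theorem sum_map_superEndo (t : Dual k 𝔤 ⊗[k] Dual k 𝔤) :
    ∑ a : ZMod 2, ∑ b : ZMod 2,
      TensorProduct.map (superEndo 𝒢 a).dualMap (superEndo 𝒢 b).dualMap t = t := by
  have hs : ∀ u : Dual k 𝔤, ∑ a : ZMod 2, (superEndo 𝒢 a).dualMap u = u := by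
    intro u
    ext x
    rw [show ∑ a : ZMod 2, (superEndo 𝒢 a).dualMap u =
      (superEndo 𝒢 0).dualMap u + (superEndo 𝒢 1).dualMap u from Fin.sum_univ_two _]
    change u (superEndo 𝒢 0 x) + u (superEndo 𝒢 1 x) = u x
    rw [← map_add, superEndo_sum]
  induction t using TensorProduct.induction_on with
  | zero => simp
  | add x y hx hy => simp only [map_add, Finset.sum_add_distrib, hx, hy]
  | tmul u w =>
    simp only [TensorProduct.map_tmul]
    simp only [← TensorProduct.tmul_sum, ← TensorProduct.sum_tmul, hs]

theorem dGen_swap {i j : ZMod 2} {f g : Dual k 𝔤} (hf : f ∈ dualPart 𝒢 i)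
    (hg : g ∈ dualPart 𝒢 j) :
    L.dGen f * SuperExterior.gen _ g = superSign i j • (SuperExterior.gen _ g * L.dGen f) := by
  have key : L.mulGen ((TensorProduct.dualDistribEquiv k 𝔤 𝔤).symm (L.bracketForm f)) *
      SuperExterior.gen _ g = superSign i j • (SuperExterior.gen _ g *
        L.mulGen ((TensorProduct.dualDistribEquiv k 𝔤 𝔤).symm (L.bracketForm f))) := by
    rw [← sum_map_superEndo (𝒢 := 𝒢)
      ((TensorProduct.dualDistribEquiv k 𝔤 𝔤).symm (L.bracketForm f))]
    simp only [map_sum, Finset.sum_mul, Finset.mul_sum, Finset.smul_sum]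
    refine Finset.sum_congr rfl fun a _ => Finset.sum_congr rfl fun b _ => ?_
    by_cases hab : a + b = i
    · rw [mulGen_swap L a b j g hg, hab]
    · rw [bracketForm_parts L hf hab]
      simp
  simp only [dGen, LinearMap.smul_apply, LinearMap.comp_apply, LinearEquiv.coe_coe,
    smul_mul_assoc, mul_smul_comm, key]
  rw [smul_comm]

/-- The algebra homomorphism `a ↦ (ε(a), ∂a; 0, a)` to upper triangular matrices, where `ε` is the
automorphism of `Λ_s(𝔤^*)` which is `(-1)^n` in degree `n`.  That it is multiplicative says that
`∂(a b) = ∂(a) b + ε(a) ∂(b)`. -/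
def dMatrix : L.Cochains →ₐ[k] Matrix (Fin 2) (Fin 2) L.Cochains :=
  SuperExterior.lift
    { toFun := fun f => !![-SuperExterior.gen _ f, L.dGen f; 0, SuperExterior.gen _ f]
      map_add' := by
        intro f g
        ext i j
        fin_cases i <;> fin_cases j <;> simp [add_comm]
      map_smul' := by
        intro c f
        ext i j
        fin_cases i <;> fin_cases j <;> simp }
    (by
      intro i j f g hf hg
      have h1 := SuperExterior.gen_swap hf hg
      have h2 := L.dGen_swap hf hg
      have h3 := L.dGen_swap hg hf
      have hs : superSign j i = superSign i j := by
        clear hf hg h1 h2 h3; revert i j; decide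
      have hss : superSign i j * superSign i j = 1 := by
        clear hf hg h1 h2 h3 hs; revert i j; decide
      ext a b
      fin_cases a <;> fin_cases b
      · simp [-zsmul_eq_mul, Matrix.mul_apply, h1]
      · have h4 : SuperExterior.gen (dualPart 𝒢) f * L.dGen g =
            superSign i j • (L.dGen g * SuperExterior.gen _ f) := by
          rw [h3, hs, ← mul_smul, hss, one_smul]
        simp [-zsmul_eq_mul, Matrix.mul_apply, h2, h4]
      · simp [-zsmul_eq_mul, Matrix.mul_apply]
      · simp [-zsmul_eq_mul, Matrix.mul_apply, h1])

/-- The Koszul differential `∂` on `C(𝔤, k) = Λ_s(𝔤^*)`. -/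
def d : L.Cochains →ₗ[k] L.Cochains where
  toFun a := L.dMatrix a 0 1
  map_add' a b := by rw [map_add, Matrix.add_apply]
  map_smul' c a := by rw [map_smul, Matrix.smul_apply, RingHom.id_apply]

theorem d_apply (a : L.Cochains) : L.d a = L.dMatrix a 0 1 := rfl

/-- The automorphism of `Λ_s(𝔤^*)` which is `(-1)^n` in degree `n`. -/
def degSign : L.Cochains →ₐ[k] L.Cochains :=
  SuperExterior.lift (-SuperExterior.gen _) (by
    intro i j f g hf hg
    simpa [-zsmul_eq_mul] using SuperExterior.gen_swap hf hg)

@[simp]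
theorem degSign_gen (f : Dual k 𝔤) :
    L.degSign (SuperExterior.gen _ f) = -SuperExterior.gen _ f := by
  simp [degSign]

theorem dMatrix_gen (f : Dual k 𝔤) :
    L.dMatrix (SuperExterior.gen _ f) =
      !![-SuperExterior.gen _ f, L.dGen f; 0, SuperExterior.gen _ f] := by
  simp [dMatrix]

theorem dMatrix_entries (a : L.Cochains) :
    L.dMatrix a 0 0 = L.degSign a ∧ L.dMatrix a 1 0 = 0 ∧ L.dMatrix a 1 1 = a := by
  induction a using SuperExterior.induction with
  | scalar c =>
    rw [AlgHom.commutes, AlgHom.commutes]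
    simp [Matrix.algebraMap_matrix_apply]
  | gen f => simp [dMatrix_gen]
  | mul a b ha hb =>
    obtain ⟨ha0, ha1, ha2⟩ := ha
    obtain ⟨hb0, hb1, hb2⟩ := hb
    simp [Matrix.mul_apply, ha0, ha1, ha2, hb0, hb1, hb2]
  | sum a b ha hb =>
    obtain ⟨ha0, ha1, ha2⟩ := ha
    obtain ⟨hb0, hb1, hb2⟩ := hb
    simp [ha0, ha1, ha2, hb0, hb1, hb2]

@[simp]
theorem d_gen (f : Dual k 𝔤) : L.d (SuperExterior.gen _ f) = L.dGen f := by
  rw [d_apply, dMatrix_gen]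
  simp

@[simp]
theorem d_algebraMap (c : k) : L.d (algebraMap k _ c) = 0 := by
  rw [d_apply, AlgHom.commutes]
  simp [Matrix.algebraMap_matrix_apply]

theorem d_mul (a b : L.Cochains) : L.d (a * b) = L.d a * b + L.degSign a * L.d b := by
  rw [d_apply, d_apply, d_apply, map_mul, Matrix.mul_apply, Fin.sum_univ_two, (L.dMatrix_entries a).1,
    (L.dMatrix_entries b).2.2, add_comm]

theorem degSign_degSign (a : L.Cochains) : L.degSign (L.degSign a) = a := by
  induction a using SuperExterior.induction with
  | scalar c => rw [AlgHom.commutes, AlgHom.commutes]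
  | gen f => simp
  | mul a b ha hb => rw [map_mul, map_mul, ha, hb]
  | sum a b ha hb => rw [map_add, map_add, ha, hb]

theorem degSign_mulGen (t : Dual k 𝔤 ⊗[k] Dual k 𝔤) : L.degSign (L.mulGen t) = L.mulGen t := by
  induction t using TensorProduct.induction_on with
  | zero => simp
  | add x y hx hy => rw [map_add, map_add, hx, hy]
  | tmul u w => simp

theorem degSign_dGen (f : Dual k 𝔤) : L.degSign (L.dGen f) = L.dGen f := by
  simp only [dGen, LinearMap.smul_apply, LinearMap.comp_apply, map_smul, degSign_mulGen]

theorem d_degSign (a : L.Cochains) : L.d (L.degSign a) = -L.degSign (L.d a) := by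
  induction a using SuperExterior.induction with
  | scalar c => rw [AlgHom.commutes, d_algebraMap, map_zero, neg_zero]
  | gen f => rw [degSign_gen, map_neg, d_gen, degSign_dGen]
  | mul a b ha hb =>
    rw [map_mul, d_mul, d_mul, ha, hb, map_add, map_mul, map_mul, neg_mul, mul_neg, neg_add]
  | sum a b ha hb => rw [map_add, map_add, map_add, ha, hb, map_add, neg_add]

theorem sum_cyclic_eq_zero {ι M : Type*} [DecidableEq ι] [AddCommGroup M] (F : ι → ι → ι → M)
    (hF : ∀ a b c, F a b c + F b c a + F c a b = 0) (hd : ∀ a, F a a a = 0) (s : Finset ι) :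
    ∑ a ∈ s, ∑ b ∈ s, ∑ c ∈ s, F a b c = 0 := by
  induction s using Finset.induction_on with
  | empty => simp
  | insert m s hm ih =>
    simp only [Finset.sum_insert hm, Finset.sum_add_distrib]
    have h1 : ∑ b ∈ s, ∑ c ∈ s, F m b c + ∑ a ∈ s, ∑ b ∈ s, F a b m +
        ∑ a ∈ s, ∑ c ∈ s, F a m c = 0 := by
      rw [Finset.sum_comm (f := fun a c => F a m c)]
      simp only [← Finset.sum_add_distrib]
      exact Finset.sum_eq_zero fun b _ => Finset.sum_eq_zero fun c _ => hF m b c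
    have h2 : ∑ c ∈ s, F m m c + ∑ c ∈ s, F m c m + ∑ c ∈ s, F c m m = 0 := by
      simp only [← Finset.sum_add_distrib]
      exact Finset.sum_eq_zero fun c _ => hF m m c
    have h3 := hd m
    generalize ∑ b ∈ s, ∑ c ∈ s, F m b c = A at *
    generalize ∑ a ∈ s, ∑ b ∈ s, F a b m = B at *
    generalize ∑ a ∈ s, ∑ c ∈ s, F a m c = C at *
    generalize ∑ c ∈ s, F m m c = D at *
    generalize ∑ c ∈ s, F m c m = E at *
    generalize ∑ c ∈ s, F c m m = G at *
    rw [h3, ih, zero_add, add_zero]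
    calc _ = (A + B + C) + (D + E + G) := by abel
      _ = 0 := by rw [h1, h2, add_zero]

theorem sum_reorder {ι M : Type*} [Fintype ι] [AddCommMonoid M] (G : ι → ι → ι → ι → M) :
    ∑ i, ∑ j, ∑ a, ∑ b, G i j a b = ∑ a, ∑ b, ∑ j, ∑ i, G i j a b := by
  calc _ = ∑ j, ∑ i, ∑ a, ∑ b, G i j a b := Finset.sum_comm
    _ = ∑ j, ∑ a, ∑ i, ∑ b, G i j a b := Finset.sum_congr rfl fun _ _ => Finset.sum_comm
    _ = ∑ j, ∑ a, ∑ b, ∑ i, G i j a b :=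
        Finset.sum_congr rfl fun _ _ => Finset.sum_congr rfl fun _ _ => Finset.sum_comm
    _ = ∑ a, ∑ j, ∑ b, ∑ i, G i j a b := Finset.sum_comm
    _ = _ := Finset.sum_congr rfl fun _ _ => Finset.sum_comm

/-- A homogeneous basis of `𝔤`. -/
theorem exists_homogeneous_basis (𝒢 : ZMod 2 → Submodule k 𝔤) [DirectSum.Decomposition 𝒢] :
    ∃ (n : Type) (_ : Fintype n) (_ : DecidableEq n) (e : Basis n k 𝔤) (par : n → ZMod 2),
      ∀ i, e i ∈ 𝒢 (par i) ∧ e.coord i ∈ dualPart 𝒢 (par i) := by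
  classical
  let b : (i : ZMod 2) → Basis (Fin (finrank k (𝒢 i))) k (𝒢 i) := fun i => finBasis k (𝒢 i)
  let e := (DirectSum.Decomposition.isInternal 𝒢).collectedBasis b
  refine ⟨_, inferInstance, inferInstance, e, Sigma.fst, fun i => ⟨?_, ?_⟩⟩
  · exact DirectSum.IsInternal.collectedBasis_mem _ b i
  · intro j hj x hx
    exact (DirectSum.Decomposition.isInternal 𝒢).collectedBasis_repr_of_mem_ne b (a := i.2) hj hx

theorem dGen_basis {n : Type} [Fintype n] [DecidableEq n] (e : Basis n k 𝔤) (f : Dual k 𝔤) :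
    L.dGen f = (-(2 : k)⁻¹) • ∑ a, ∑ b, f (L.bracket (e b) (e a)) •
      (SuperExterior.gen _ (e.coord a) * SuperExterior.gen _ (e.coord b)) := by
  have h : (TensorProduct.dualDistribEquiv k 𝔤 𝔤).symm (L.bracketForm f) =
      ∑ a, ∑ b, f (L.bracket (e b) (e a)) • (e.coord a ⊗ₜ[k] e.coord b) := by
    rw [LinearEquiv.symm_apply_eq]
    refine (e.tensorProduct e).ext fun i => ?_
    obtain ⟨i, j⟩ := i
    rw [Basis.tensorProduct_apply]
    simp [bracketForm, TensorProduct.dualDistribEquiv, TensorProduct.dualDistribEquivOfBasis,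
      Finsupp.single_apply]
  simp only [dGen, LinearMap.smul_apply, LinearMap.comp_apply, LinearEquiv.coe_coe, h, map_sum,
    map_smul, mulGen_tmul]

theorem smul_triple_swap {i j l : ZMod 2} {u v w : Dual k 𝔤} (hu : u ∈ dualPart 𝒢 i)
    (hv : v ∈ dualPart 𝒢 j) (hw : w ∈ dualPart 𝒢 l) :
    SuperExterior.gen _ u * SuperExterior.gen _ v * SuperExterior.gen _ w =
      superSign (i + j) l • (SuperExterior.gen (dualPart 𝒢) w *
        (SuperExterior.gen _ u * SuperExterior.gen _ v)) := by
  rw [mul_assoc, SuperExterior.gen_swap hv hw, mul_neg, mul_smul_comm, ← mul_assoc,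
    SuperExterior.gen_swap hu hw, superSign_add, mul_smul, neg_mul, smul_mul_assoc, smul_neg,
    neg_neg, smul_comm, mul_assoc]

theorem d_dGen (f : Dual k 𝔤) : L.d (L.dGen f) = 0 := by
  by_cases hk : (2 : k) = 0
  · simp [dGen, hk]
  obtain ⟨n, _, _, e, par, he⟩ := exists_homogeneous_basis 𝒢
  set x : n → L.Cochains := fun a => SuperExterior.gen _ (e.coord a) with hx
  set c : k := -(2 : k)⁻¹
  have hd : ∀ h : Dual k 𝔤, L.dGen h = c • ∑ a, ∑ b, h (L.bracket (e b) (e a)) • (x a * x b) :=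
    fun h => L.dGen_basis e h
  have hexp : ∀ (y : 𝔤) (h : Dual k 𝔤), ∑ i, e.coord i y * h (e i) = h y := by
    intro y h
    conv_rhs => rw [← e.sum_repr y, map_sum]
    simp
  -- the two triple sums
  have h1 : L.d (L.dGen f) = (c * c) • ∑ a, ∑ b, ∑ j,
      (f (L.bracket (e j) (L.bracket (e b) (e a))) • (x a * x b * x j) -
        f (L.bracket (L.bracket (e b) (e a)) (e j)) • (x j * (x a * x b))) := by
    have hA : ∑ i, ∑ j, f (L.bracket (e j) (e i)) • (L.dGen (e.coord i) * x j) =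
        c • ∑ a, ∑ b, ∑ j, f (L.bracket (e j) (L.bracket (e b) (e a))) • (x a * x b * x j) := by
      calc _ = c • ∑ i, ∑ j, ∑ a, ∑ b, (e.coord i (L.bracket (e b) (e a)) *
            f (L.bracket (e j) (e i))) • (x a * x b * x j) := by
            simp only [hd, Finset.smul_sum, Finset.sum_mul, smul_mul_assoc, smul_smul]
            refine Finset.sum_congr rfl fun i _ => Finset.sum_congr rfl fun j _ =>
              Finset.sum_congr rfl fun a _ => Finset.sum_congr rfl fun b _ => ?_
            congr 1
            ring
        _ = c • ∑ a, ∑ b, ∑ j, ∑ i, (e.coord i (L.bracket (e b) (e a)) *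
            f (L.bracket (e j) (e i))) • (x a * x b * x j) := by
            rw [sum_reorder]
        _ = _ := by
            simp only [← Finset.sum_smul]
            refine congrArg (c • ·) (Finset.sum_congr rfl fun a _ => Finset.sum_congr rfl fun b _ =>
              Finset.sum_congr rfl fun j _ => ?_)
            have h := hexp (L.bracket (e b) (e a)) (f ∘ₗ L.bracket (e j))
            simp only [LinearMap.comp_apply] at h
            rw [h]
    have hB : ∑ i, ∑ j, f (L.bracket (e j) (e i)) • (x i * L.dGen (e.coord j)) =
        c • ∑ a, ∑ b, ∑ j, f (L.bracket (L.bracket (e b) (e a)) (e j)) • (x j * (x a * x b)) := by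
      calc _ = c • ∑ j, ∑ i, ∑ a, ∑ b, (e.coord j (L.bracket (e b) (e a)) *
            f (L.bracket (e j) (e i))) • (x i * (x a * x b)) := by
            rw [Finset.sum_comm]
            simp only [hd, Finset.smul_sum, Finset.mul_sum, mul_smul_comm, smul_smul]
            refine Finset.sum_congr rfl fun i _ => Finset.sum_congr rfl fun j _ =>
              Finset.sum_congr rfl fun a _ => Finset.sum_congr rfl fun b _ => ?_
            congr 1
            ring
        _ = c • ∑ a, ∑ b, ∑ i, ∑ j, (e.coord j (L.bracket (e b) (e a)) *
            f (L.bracket (e j) (e i))) • (x i * (x a * x b)) := by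
            rw [sum_reorder]
        _ = _ := by
            simp only [← Finset.sum_smul]
            refine congrArg (c • ·) (Finset.sum_congr rfl fun a _ => Finset.sum_congr rfl fun b _ =>
              Finset.sum_congr rfl fun i _ => ?_)
            have h := hexp (L.bracket (e b) (e a)) (f ∘ₗ L.bracket.flip (e i))
            simp only [LinearMap.comp_apply, LinearMap.flip_apply] at h
            rw [h]
    have hC : L.d (L.dGen f) = c • (∑ i, ∑ j, f (L.bracket (e j) (e i)) •
        (L.dGen (e.coord i) * x j) - ∑ i, ∑ j, f (L.bracket (e j) (e i)) •
          (x i * L.dGen (e.coord j))) := by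
      rw [hd f, map_smul, map_sum, ← Finset.sum_sub_distrib]
      congr 1
      refine Finset.sum_congr rfl fun i _ => ?_
      rw [map_sum, ← Finset.sum_sub_distrib]
      refine Finset.sum_congr rfl fun j _ => ?_
      rw [map_smul, d_mul, hx, d_gen, d_gen, degSign_gen, neg_mul, ← smul_sub, sub_eq_add_neg]
    rw [hC, hA, hB, ← smul_sub, smul_smul]
    simp only [Finset.sum_sub_distrib]
  -- both sums agree up to sign
  have h2 : ∀ a b j, f (L.bracket (L.bracket (e b) (e a)) (e j)) • (x j * (x a * x b)) =
      -(f (L.bracket (e j) (L.bracket (e b) (e a))) • (x a * x b * x j)) := by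
    intro a b j
    rw [smul_triple_swap (he a).2 (he b).2 (he j).2, L.bracket_skew _ _ _ _
      (L.bracket_mem _ _ _ _ (he b).1 (he a).1) (he j).1]
    rw [add_comm (par b) (par a)]
    have hs : ∀ i j, superSign i j = 1 ∨ superSign i j = -1 := by decide
    rcases hs (par a + par b) (par j) with h | h <;> rw [h] <;> simp [hx]
  have h3 : ∑ a, ∑ b, ∑ j, f (L.bracket (e j) (L.bracket (e b) (e a))) • (x a * x b * x j) = 0 := by
    refine sum_cyclic_eq_zero _ ?_ ?_ Finset.univ
    · intro a b j
      have e1 : x b * x j * x a =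
          superSign (par b + par j) (par a) • (x a * x b * x j) := by
        rw [hx, smul_triple_swap (he b).2 (he j).2 (he a).2, mul_assoc]
      have e2 : x j * x a * x b =
          superSign (par a + par b) (par j) • (x a * x b * x j) := by
        rw [hx, smul_triple_swap (he a).2 (he b).2 (he j).2, ← mul_smul, mul_assoc]
        have hs : ∀ i j, superSign i j * superSign i j = 1 := by decide
        rw [hs, one_smul]
      have jac := L.jacobi _ _ _ _ _ _ (he j).1 (he b).1 (he a).1
      have s1 := L.bracket_skew _ _ _ _ (L.bracket_mem _ _ _ _ (he j).1 (he b).1) (he a).1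
      have s2 := L.bracket_skew _ _ _ _ (he j).1 (he a).1
      have hs : ∀ i j l, superSign j i * superSign j l = superSign (i + l) j := by decide
      rw [e1, e2, jac, s1, s2, add_comm (par j) (par b), map_neg, map_zsmul, smul_neg, ← mul_smul,
        hs, map_add, map_neg, map_neg, map_zsmul, map_zsmul, add_comm (par b) (par a)]
      simp only [add_smul, neg_smul, smul_assoc, smul_comm (superSign _ _)]
      abel
    · intro a
      have hp : ∀ i : ZMod 2, i = 0 ∨ i = 1 := by decide
      rcases hp (par a) with h | h
      · have h1 := L.bracket_skew _ _ _ _ (he a).1 (he a).1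
        have hs : superSign 0 0 = 1 := by decide
        rw [h, hs, one_zsmul, eq_neg_iff_add_eq_zero, ← two_smul k] at h1
        rw [(smul_eq_zero.1 h1).resolve_left hk, map_zero, map_zero, zero_smul]
      · have h1 := L.bracket_odd_cube (e a) (by rw [← h]; exact (he a).1)
        rw [h1, map_zero, zero_smul]
  rw [h1]
  simp only [h2, sub_neg_eq_add, Finset.sum_add_distrib, h3, add_zero, smul_zero]

theorem d_d (a : L.Cochains) : L.d (L.d a) = 0 := by
  induction a using SuperExterior.induction with
  | scalar c => rw [d_algebraMap, map_zero]
  | gen f => rw [d_gen, d_dGen]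
  | mul a b ha hb =>
    rw [d_mul, map_add, d_mul, d_mul, ha, hb, d_degSign, degSign_degSign, zero_mul, mul_zero,
      neg_mul]
    abel
  | sum a b ha hb => rw [map_add, map_add, ha, hb, add_zero]

/-! ### The cohomology ring -/

/-- The subalgebra of cocycles. -/
def cocycles : Subalgebra k L.Cochains where
  carrier := {z | L.d z = 0}
  mul_mem' := by
    intro a b ha hb
    change L.d a = 0 at ha
    change L.d b = 0 at hb
    change L.d _ = 0
    rw [d_mul, ha, hb, zero_mul, mul_zero, add_zero]
  add_mem' := by
    intro a b ha hb
    change L.d a = 0 at ha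
    change L.d b = 0 at hb
    change L.d _ = 0
    rw [map_add, ha, hb, add_zero]
  algebraMap_mem' := L.d_algebraMap

theorem mem_cocycles {z : L.Cochains} : z ∈ L.cocycles ↔ L.d z = 0 := Iff.rfl

/-- The ideal of coboundaries, i.e. the image of `∂` (recall `d_d`), in the algebra of cocycles. -/
def coboundaries : Ideal L.cocycles where
  carrier := {z | ∃ a, L.d a = z}
  add_mem' := by
    rintro _ _ ⟨a, ha⟩ ⟨b, hb⟩
    exact ⟨a + b, by rw [map_add, ha, hb]; rfl⟩
  zero_mem' := ⟨0, map_zero _⟩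
  smul_mem' := by
    rintro z _ ⟨a, ha⟩
    refine ⟨L.degSign z * a, ?_⟩
    rw [d_mul, d_degSign, L.mem_cocycles.1 z.2, map_zero, neg_zero, zero_mul, zero_add,
      degSign_degSign, ha]
    rfl

instance coboundaries_isTwoSided : L.coboundaries.IsTwoSided where
  mul_mem_of_left := by
    rintro _ z ⟨a, ha⟩
    refine ⟨a * z, ?_⟩
    rw [d_mul, L.mem_cocycles.1 z.2, mul_zero, add_zero, ha]
    rfl

/-- The cohomology ring `H^•(𝔤, k)`: cocycles modulo coboundaries, with the product induced from
`Λ_s(𝔤^*)`. -/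
def Cohomology := L.cocycles ⧸ L.coboundaries

instance ringCohomology : Ring L.Cohomology :=
  inferInstanceAs (Ring (L.cocycles ⧸ L.coboundaries))

/-- The cohomology class of a cocycle. -/
def toCohomology : L.cocycles →+* L.Cohomology := Ideal.Quotient.mk L.coboundaries

theorem toCohomology_surjective : Function.Surjective L.toCohomology :=
  Ideal.Quotient.mk_surjective

/-! ### Nilpotent elements and maximal ideals of the cohomology ring -/

/-- The inclusion of generators of odd parity, `𝔤₁^* → Λ_s(𝔤^*)`; a functional on `𝔤₁` is extended
by zero on `𝔤₀`. -/
def oddGen : Dual k (𝒢 1) →ₗ[k] L.Cochains :=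
  SuperExterior.gen (dualPart 𝒢) ∘ₗ (superProj 𝒢 1).dualMap

theorem dualMap_superProj_mem (f : Dual k (𝒢 1)) :
    (superProj 𝒢 1).dualMap f ∈ dualPart 𝒢 1 := by
  intro j hj x hx
  have h : superProj 𝒢 1 x = 0 := Subtype.ext (superEndo_of_ne 𝒢 hj hx)
  simp [h]

theorem oddGen_comm (f g : Dual k (𝒢 1)) : L.oddGen f * L.oddGen g = L.oddGen g * L.oddGen f := by
  have h := SuperExterior.gen_swap (dualMap_superProj_mem f) (dualMap_superProj_mem g)
  simpa [superSign, oddGen] using h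

/-- The inclusion `S(𝔤₁^*) → Λ_s(𝔤^*)`. -/
def symIncl : SymmetricAlgebra k (Dual k (𝒢 1)) →ₐ[k] L.Cochains :=
  RingCon.liftₐ (TensorAlgebra.symRingCon k (Dual k (𝒢 1))) (TensorAlgebra.lift k L.oddGen) (by
    refine RingCon.ringConGen_le.2 fun x y h => ?_
    obtain ⟨f, g⟩ := h
    simpa using L.oddGen_comm f g)

@[simp]
theorem symIncl_ι (f : Dual k (𝒢 1)) :
    L.symIncl (SymmetricAlgebra.ι k _ f) = L.oddGen f := by
  exact (RingCon.liftₐ_mk _ _ _ _).trans (TensorAlgebra.lift_ι_apply _ f)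

/-- Generators of even parity anticommute with all generators. -/
theorem even_gen_mul {e : Dual k 𝔤} (he : e ∈ dualPart 𝒢 0) (a : L.Cochains) :
    SuperExterior.gen _ e * a = L.degSign a * SuperExterior.gen _ e := by
  have hs : ∀ f : Dual k 𝔤, f = f ∘ₗ superEndo 𝒢 0 + f ∘ₗ superEndo 𝒢 1 := by
    intro f
    ext x
    simp only [LinearMap.add_apply, LinearMap.comp_apply]
    rw [← map_add, superEndo_sum]
  induction a using SuperExterior.induction with
  | scalar c => rw [AlgHom.commutes, Algebra.commutes]
  | gen f =>
    have h0 := SuperExterior.gen_swap he (comp_superEndo_mem 𝒢 f 0)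
    have h1 := SuperExterior.gen_swap he (comp_superEndo_mem 𝒢 f 1)
    have hs0 : ∀ j, superSign 0 j = 1 := by decide
    rw [hs0, one_smul] at h0 h1
    rw [degSign_gen, neg_mul, hs f, map_add, mul_add, h0, h1, add_mul, neg_add]
  | mul a b ha hb => rw [map_mul, ← mul_assoc, ha, mul_assoc, hb, mul_assoc]
  | sum a b ha hb => rw [map_add, mul_add, ha, hb, add_mul]

/-- The left ideal generated by some even generators is closed under right multiplication. -/
theorem span_even_mul {s : Set (Dual k 𝔤)} (hs : s ⊆ dualPart 𝒢 0) {x : L.Cochains}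
    (hx : x ∈ Ideal.span (SuperExterior.gen (dualPart 𝒢) '' s)) (a : L.Cochains) :
    x * a ∈ Ideal.span (SuperExterior.gen (dualPart 𝒢) '' s) := by
  induction hx using Submodule.span_induction with
  | mem x hx =>
    obtain ⟨e, he, rfl⟩ := hx
    rw [even_gen_mul L (hs he)]
    exact Ideal.mul_mem_left _ _ (Ideal.subset_span ⟨e, he, rfl⟩)
  | zero => rw [zero_mul]; exact Ideal.zero_mem _
  | add x y _ _ hx hy => rw [add_mul]; exact Ideal.add_mem _ hx hy
  | smul c x _ hx => rw [smul_eq_mul, mul_assoc]; exact Ideal.mul_mem_left _ _ hx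

theorem isNilpotent_of_mem_span (hk : (2 : k) ≠ 0) (s : Finset (Dual k 𝔤)) :
    (s : Set (Dual k 𝔤)) ⊆ dualPart 𝒢 0 → ∀ x : L.Cochains,
      x ∈ Ideal.span (SuperExterior.gen (dualPart 𝒢) '' (s : Set (Dual k 𝔤))) →
        IsNilpotent x := by
  classical
  induction s using Finset.induction_on with
  | empty =>
    intro _ x hx
    simp only [Finset.coe_empty, Set.image_empty, Ideal.span_empty, Ideal.mem_bot] at hx
    rw [hx]
    exact IsNilpotent.zero
  | insert e s _ ih =>
    intro hs x hx
    have he : e ∈ dualPart 𝒢 0 := hs (by simp)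
    have hs' : (s : Set (Dual k 𝔤)) ⊆ dualPart 𝒢 0 := fun y hy => hs (by simp [hy])
    have hee : SuperExterior.gen (dualPart 𝒢) e * SuperExterior.gen (dualPart 𝒢) e = 0 := by
      have h := even_gen_mul L he (SuperExterior.gen (dualPart 𝒢) e)
      rw [degSign_gen, neg_mul, eq_neg_iff_add_eq_zero, ← two_smul k] at h
      exact (smul_eq_zero.1 h).resolve_left hk
    rw [Finset.coe_insert, Set.image_insert_eq, Ideal.span_insert, Submodule.mem_sup] at hx
    obtain ⟨y, hy, z, hz, rfl⟩ := hx
    obtain ⟨c, rfl⟩ := Ideal.mem_span_singleton'.1 hy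
    have h0 : c * SuperExterior.gen _ e * (c * SuperExterior.gen _ e) = 0 := by
      have h1 : SuperExterior.gen (dualPart 𝒢) e * (c * SuperExterior.gen _ e) = 0 := by
        rw [← mul_assoc, even_gen_mul L he c, mul_assoc, hee, mul_zero]
      rw [mul_assoc, h1, mul_zero]
    obtain ⟨n, hn⟩ := ih hs' ((c * SuperExterior.gen _ e + z) ^ 2) (by
      rw [sq, add_mul, mul_add, h0, zero_add]
      exact Ideal.add_mem _ (Ideal.mul_mem_left _ _ hz) (span_even_mul L hs' hz _))
    exact ⟨2 * n, by rw [pow_mul, hn]⟩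

/-- The ideal of `Λ_s(𝔤^*)` generated by `𝔤₀^*` consists of nilpotent elements. -/
theorem isNilpotent_of_mem_evenIdeal (hk : (2 : k) ≠ 0) {x : L.Cochains}
    (hx : x ∈ Ideal.span (SuperExterior.gen (dualPart 𝒢) '' (dualPart 𝒢 0 : Set (Dual k 𝔤)))) :
    IsNilpotent x := by
  obtain ⟨s, hs⟩ := (IsNoetherian.noetherian (dualPart 𝒢 0))
  have hs' : (s : Set (Dual k 𝔤)) ⊆ dualPart 𝒢 0 := by
    rw [← hs]
    exact Submodule.subset_span
  refine isNilpotent_of_mem_span L hk s hs' x (Ideal.span_le.2 ?_ hx)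
  rintro _ ⟨e, he, rfl⟩
  rw [SetLike.mem_coe, ← hs] at he
  induction he using Submodule.span_induction with
  | mem e he => exact Ideal.subset_span ⟨e, he, rfl⟩
  | zero => rw [map_zero]; exact Ideal.zero_mem _
  | add e f _ _ he hf => rw [map_add]; exact Ideal.add_mem _ he hf
  | smul c e _ he =>
    rw [map_smul, Algebra.smul_def]
    exact Ideal.mul_mem_left _ _ he

theorem exists_symIncl_sub_mem (a : L.Cochains) :
    ∃ q, a - L.symIncl q ∈
      Ideal.span (SuperExterior.gen (dualPart 𝒢) '' (dualPart 𝒢 0 : Set (Dual k 𝔤))) := by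
  induction a using SuperExterior.induction with
  | scalar c =>
    refine ⟨algebraMap k _ c, ?_⟩
    rw [AlgHom.commutes, sub_self]
    exact Ideal.zero_mem _
  | gen f =>
    refine ⟨SymmetricAlgebra.ι k _ (f ∘ₗ (𝒢 1).subtype), ?_⟩
    have h : SuperExterior.gen (dualPart 𝒢) f - L.oddGen (f ∘ₗ (𝒢 1).subtype) =
        SuperExterior.gen (dualPart 𝒢) (f ∘ₗ superEndo 𝒢 0) := by
      rw [oddGen, LinearMap.comp_apply, ← map_sub]
      congr 1
      ext x
      change f x - f (superEndo 𝒢 1 x) = f (superEndo 𝒢 0 x)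
      rw [sub_eq_iff_eq_add, ← map_add, superEndo_sum]
    rw [symIncl_ι, h]
    exact Ideal.subset_span ⟨_, comp_superEndo_mem 𝒢 f 0, rfl⟩
  | mul a b ha hb =>
    obtain ⟨q, hq⟩ := ha
    obtain ⟨r, hr⟩ := hb
    refine ⟨q * r, ?_⟩
    have h : a * b - L.symIncl (q * r) =
        (a - L.symIncl q) * b + L.symIncl q * (b - L.symIncl r) := by
      rw [map_mul]
      noncomm_ring
    rw [h]
    exact Ideal.add_mem _ (span_even_mul L (fun _ h => h) hq _) (Ideal.mul_mem_left _ _ hr)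
  | sum a b ha hb =>
    obtain ⟨q, hq⟩ := ha
    obtain ⟨r, hr⟩ := hb
    refine ⟨q + r, ?_⟩
    rw [map_add, add_sub_add_comm]
    exact Ideal.add_mem _ hq hr

/-- Modulo the ideal generated by `𝔤₀^*`, the algebra `Λ_s(𝔤^*)` is commutative. -/
theorem mul_sub_mul_mem (a b : L.Cochains) : a * b - b * a ∈
    Ideal.span (SuperExterior.gen (dualPart 𝒢) '' (dualPart 𝒢 0 : Set (Dual k 𝔤))) := by
  obtain ⟨q, hq⟩ := L.exists_symIncl_sub_mem a
  obtain ⟨r, hr⟩ := L.exists_symIncl_sub_mem b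
  have h : a * b - b * a = (a - L.symIncl q) * b + L.symIncl q * (b - L.symIncl r) -
      ((b - L.symIncl r) * a + L.symIncl r * (a - L.symIncl q)) := by
    have hc : L.symIncl q * L.symIncl r = L.symIncl r * L.symIncl q := by
      rw [← map_mul, mul_comm, map_mul]
    simp only [sub_mul, mul_sub, hc]
    abel
  rw [h]
  exact Ideal.sub_mem _
    (Ideal.add_mem _ (span_even_mul L (fun _ h => h) hq _) (Ideal.mul_mem_left _ _ hr))
    (Ideal.add_mem _ (span_even_mul L (fun _ h => h) hr _) (Ideal.mul_mem_left _ _ hq))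

/-- The ideal of the cohomology ring consisting of the classes which have a representative in the
ideal of `Λ_s(𝔤^*)` generated by `𝔤₀^*`. -/
def evenClasses : Ideal L.Cohomology where
  carrier := {h | ∃ z : L.cocycles, (z : L.Cochains) ∈
    Ideal.span (SuperExterior.gen (dualPart 𝒢) '' (dualPart 𝒢 0 : Set (Dual k 𝔤))) ∧
      L.toCohomology z = h}
  add_mem' := by
    rintro _ _ ⟨y, hy, rfl⟩ ⟨z, hz, rfl⟩
    exact ⟨y + z, Ideal.add_mem _ hy hz, map_add _ _ _⟩
  zero_mem' := ⟨0, Ideal.zero_mem _, map_zero _⟩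
  smul_mem' := by
    rintro h _ ⟨z, hz, rfl⟩
    obtain ⟨y, rfl⟩ := L.toCohomology_surjective h
    exact ⟨y * z, Ideal.mul_mem_left _ _ hz, map_mul _ _ _⟩

instance evenClasses_isTwoSided : L.evenClasses.IsTwoSided where
  mul_mem_of_left := by
    rintro _ h ⟨z, hz, rfl⟩
    obtain ⟨y, rfl⟩ := L.toCohomology_surjective h
    exact ⟨z * y, span_even_mul L (fun _ h => h) hz _, map_mul _ _ _⟩

theorem cochains_comm_of_two_eq_zero (hk : (2 : k) = 0) (a b : L.Cochains) : a * b = b * a := by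
  have hneg : ∀ x : L.Cochains, -x = x := by
    intro x
    rw [neg_eq_iff_add_eq_zero, ← two_smul k, hk, zero_smul]
  have hsign : ∀ (i j : ZMod 2) (x : L.Cochains), superSign i j • x = x := by
    intro i j x
    rw [superSign]
    split_ifs
    · rw [neg_one_zsmul, hneg]
    · rw [one_zsmul]
  have hs : ∀ f : Dual k 𝔤, f = f ∘ₗ superEndo 𝒢 0 + f ∘ₗ superEndo 𝒢 1 := by
    intro f
    ext x
    simp only [LinearMap.add_apply, LinearMap.comp_apply]
    rw [← map_add, superEndo_sum]
  have hgen : ∀ f g : Dual k 𝔤, Commute (SuperExterior.gen (dualPart 𝒢) f)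
      (SuperExterior.gen (dualPart 𝒢) g) := by
    intro f g
    have h : ∀ i j, Commute (SuperExterior.gen (dualPart 𝒢) (f ∘ₗ superEndo 𝒢 i))
        (SuperExterior.gen (dualPart 𝒢) (g ∘ₗ superEndo 𝒢 j)) := by
      intro i j
      have h := SuperExterior.gen_swap (comp_superEndo_mem 𝒢 f i) (comp_superEndo_mem 𝒢 g j)
      rwa [hsign, hneg] at h
    rw [hs f, hs g, map_add, map_add]
    exact ((h 0 0).add_right (h 0 1)).add_left ((h 1 0).add_right (h 1 1))
  change Commute a b
  induction a using SuperExterior.induction with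
  | scalar c => exact Algebra.commute_algebraMap_left _ _
  | gen f =>
    induction b using SuperExterior.induction with
    | scalar c => exact Algebra.commute_algebraMap_right _ _
    | gen g => exact hgen f g
    | mul a b ha hb => exact ha.mul_right hb
    | sum a b ha hb => exact ha.add_right hb
  | mul a b ha hb => exact ha.mul_left hb
  | sum a b ha hb => exact ha.add_left hb

/-- Commutators in the cohomology ring lie in an ideal consisting of nilpotent elements. -/
theorem exists_nil_ideal : ∃ I : Ideal L.Cohomology, I.IsTwoSided ∧
    (∀ x ∈ I, IsNilpotent x) ∧ ∀ a b, a * b - b * a ∈ I := by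
  by_cases hk : (2 : k) = 0
  · refine ⟨⊥, inferInstance, ?_, ?_⟩
    · intro x hx
      rw [Ideal.mem_bot.1 hx]
      exact IsNilpotent.zero
    · intro a b
      obtain ⟨y, rfl⟩ := L.toCohomology_surjective a
      obtain ⟨z, rfl⟩ := L.toCohomology_surjective b
      have h : y * z = z * y := Subtype.ext (L.cochains_comm_of_two_eq_zero hk y z)
      rw [← map_mul, ← map_mul, h, sub_self]
      exact Ideal.zero_mem _
  · refine ⟨L.evenClasses, inferInstance, ?_, ?_⟩
    · rintro _ ⟨z, hz, rfl⟩
      obtain ⟨n, hn⟩ := L.isNilpotent_of_mem_evenIdeal hk hz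
      refine ⟨n, ?_⟩
      have h : z ^ n = 0 := Subtype.ext hn
      rw [← map_pow, h, map_zero]
    · intro a b
      obtain ⟨y, rfl⟩ := L.toCohomology_surjective a
      obtain ⟨z, rfl⟩ := L.toCohomology_surjective b
      exact ⟨y * z - z * y, L.mul_sub_mul_mem y z, by rw [map_sub, map_mul, map_mul]⟩

theorem isNilpotent_add_of_comm_mod_nil {A : Type*} [Ring A] (I : Ideal A) [I.IsTwoSided]
    (hnil : ∀ x ∈ I, IsNilpotent x) (hcomm : ∀ a b, a * b - b * a ∈ I) {a b : A}
    (ha : IsNilpotent a) (hb : IsNilpotent b) : IsNilpotent (a + b) := by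
  have hc : Commute (Ideal.Quotient.mk I a) (Ideal.Quotient.mk I b) := by
    rw [commute_iff_eq, ← map_mul, ← map_mul]
    exact Ideal.Quotient.eq.2 (hcomm a b)
  obtain ⟨n, hn⟩ := hc.isNilpotent_add (ha.map (Ideal.Quotient.mk I))
    (hb.map (Ideal.Quotient.mk I))
  rw [← map_add, ← map_pow] at hn
  obtain ⟨m, hm⟩ := hnil _ (Ideal.Quotient.eq_zero_iff_mem.1 hn)
  exact ⟨n * m, by rw [pow_mul, hm]⟩

theorem isNilpotent_mul_of_comm_mod_nil {A : Type*} [Ring A] (I : Ideal A) [I.IsTwoSided]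
    (hnil : ∀ x ∈ I, IsNilpotent x) (hcomm : ∀ a b, a * b - b * a ∈ I) {a b : A}
    (h : IsNilpotent a ∨ IsNilpotent b) : IsNilpotent (a * b) := by
  have hc : Commute (Ideal.Quotient.mk I a) (Ideal.Quotient.mk I b) := by
    rw [commute_iff_eq, ← map_mul, ← map_mul]
    exact Ideal.Quotient.eq.2 (hcomm a b)
  have hn : IsNilpotent (Ideal.Quotient.mk I a * Ideal.Quotient.mk I b) := by
    rcases h with h | h
    · exact hc.isNilpotent_mul_right (h.map (Ideal.Quotient.mk I))
    · exact hc.isNilpotent_mul_left (h.map (Ideal.Quotient.mk I))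
  obtain ⟨n, hn⟩ := hn
  rw [← map_mul, ← map_pow] at hn
  obtain ⟨m, hm⟩ := hnil _ (Ideal.Quotient.eq_zero_iff_mem.1 hn)
  exact ⟨n * m, by rw [pow_mul, hm]⟩

theorem cohomology_isNilpotent_add {a b : L.Cohomology} (ha : IsNilpotent a)
    (hb : IsNilpotent b) : IsNilpotent (a + b) := by
  obtain ⟨I, hI, hnil, hcomm⟩ := L.exists_nil_ideal
  exact isNilpotent_add_of_comm_mod_nil I hnil hcomm ha hb

theorem cohomology_isNilpotent_mul {a b : L.Cohomology} (h : IsNilpotent a ∨ IsNilpotent b) :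
    IsNilpotent (a * b) := by
  obtain ⟨I, hI, hnil, hcomm⟩ := L.exists_nil_ideal
  exact isNilpotent_mul_of_comm_mod_nil I hnil hcomm h

/-- The ideal `Nil(H^•(𝔤, k))` of all nilpotent elements of the cohomology ring. -/
def nilIdeal : Ideal L.Cohomology where
  carrier := {x | IsNilpotent x}
  add_mem' := L.cohomology_isNilpotent_add
  zero_mem' := IsNilpotent.zero
  smul_mem' _ _ hx := L.cohomology_isNilpotent_mul (Or.inr hx)

instance nilIdeal_isTwoSided : L.nilIdeal.IsTwoSided where
  mul_mem_of_left _ ha := L.cohomology_isNilpotent_mul (Or.inl ha)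

/-- The reduced commutative ring `H^•(𝔤, k) / Nil(H^•(𝔤, k))`. -/
def ReducedCohomology := L.Cohomology ⧸ L.nilIdeal

instance ringReducedCohomology : Ring L.ReducedCohomology :=
  inferInstanceAs (Ring (L.Cohomology ⧸ L.nilIdeal))

instance commRingReducedCohomology : CommRing L.ReducedCohomology where
  __ := L.ringReducedCohomology
  mul_comm a b := by
    obtain ⟨x, rfl⟩ := Ideal.Quotient.mk_surjective (I := L.nilIdeal) a
    obtain ⟨y, rfl⟩ := Ideal.Quotient.mk_surjective (I := L.nilIdeal) b
    obtain ⟨I, _, hnil, hcomm⟩ := L.exists_nil_ideal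
    exact Ideal.Quotient.eq.2 (hnil _ (hcomm x y))

/-- The quotient map `H^•(𝔤, k) → H^•(𝔤, k) / Nil(H^•(𝔤, k))`. -/
def toReduced : L.Cohomology →+* L.ReducedCohomology := Ideal.Quotient.mk L.nilIdeal

/-- The cohomology variety `|U(𝔤)| = Max(H^•(𝔤, k))`: the maximal ideals of
`H^•(𝔤, k) / Nil(H^•(𝔤, k))` with the Zariski topology. -/
abbrev CohomologyVariety := MaximalSpectrum L.ReducedCohomology

/-! ### The `p`-power map `φ` and the variety `𝒳_𝔤(k)` -/

/-- The ring `S(𝔤₁^*)` of polynomial functions on `𝔤₁`. -/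
abbrev OddFunctions (_L : LieSuperalgebra k 𝒢) := SymmetricAlgebra k (Dual k (𝒢 1))

theorem dGen_mul_oddGen (f : Dual k (𝒢 1)) :
    L.d (L.oddGen f) * L.oddGen f = -(L.oddGen f * L.d (L.oddGen f)) := by
  have h := L.dGen_swap (dualMap_superProj_mem f) (dualMap_superProj_mem f)
  have hs : superSign 1 1 = -1 := by decide
  rw [hs, neg_one_zsmul] at h
  simpa [oddGen] using h

theorem d_oddGen_mul_pow (f : Dual k (𝒢 1)) (n : ℕ) :
    L.d (L.oddGen f) * L.oddGen f ^ n = (-1 : k) ^ n • (L.oddGen f ^ n * L.d (L.oddGen f)) := by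
  induction n with
  | zero => simp
  | succ n ih =>
    rw [pow_succ, ← mul_assoc, ih, smul_mul_assoc, mul_assoc, dGen_mul_oddGen, mul_neg,
      ← mul_assoc, pow_succ, mul_neg_one, neg_smul, smul_neg]

theorem d_oddGen_pow (f : Dual k (𝒢 1)) (n : ℕ) :
    L.d (L.oddGen f ^ (n + 1)) =
      ((-1) ^ n * ((n + 1 : ℕ) : k)) • (L.oddGen f ^ n * L.d (L.oddGen f)) := by
  induction n with
  | zero => simp
  | succ n ih =>
    have hsg : L.degSign (L.oddGen f) = -L.oddGen f := L.degSign_gen _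
    rw [pow_succ', d_mul, hsg, ih, d_oddGen_mul_pow, neg_mul, mul_smul_comm, ← mul_assoc,
      ← pow_succ', ← neg_smul, ← add_smul]
    congr 1
    push_cast
    ring

section Power

variable (p : ℕ) [Fact p.Prime] [CharP k p]

instance expCharOddFunctions : ExpChar (SymmetricAlgebra k (Dual k (𝒢 1))) p :=
  haveI : ExpChar k p := ExpChar.prime Fact.out
  expChar_of_injective_algebraMap (algebraMap k _).injective p

/-- The `p`-power map `φ̃ : S(𝔤₁^*[p])^{(1)} → Λ_s(𝔤^*)`, `z ↦ z^p`.  The Frobenius twist `(1)` and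
the shift `[p]` only change the `k`-linear structure (which makes this semilinear map linear) and
the grading: the ring underlying `S(𝔤₁^*[p])^{(1)}` is `S(𝔤₁^*)`. -/
def powMap : L.OddFunctions →+* L.Cochains :=
  (L.symIncl : L.OddFunctions →+* L.Cochains).comp (frobenius L.OddFunctions p)

theorem powMap_apply (q : L.OddFunctions) : L.powMap p q = L.symIncl q ^ p := by
  simp [powMap, frobenius_def]

theorem powMap_mem_cocycles (q : L.OddFunctions) : L.powMap p q ∈ L.cocycles := by
  induction q using SymmetricAlgebra.induction with
  | algebraMap c =>
    rw [powMap_apply, AlgHom.commutes, ← map_pow]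
    exact L.d_algebraMap _
  | ι f =>
    have hp : p = p - 1 + 1 := (Nat.sub_add_cancel (Fact.out : p.Prime).one_le).symm
    rw [powMap_apply, symIncl_ι, mem_cocycles]
    rw [hp, d_oddGen_pow, ← hp, CharP.cast_eq_zero, mul_zero, zero_smul]
  | mul a b ha hb => rw [map_mul]; exact Subalgebra.mul_mem _ ha hb
  | add a b ha hb => rw [map_add]; exact Subalgebra.add_mem _ ha hb

/-- The ring homomorphism `φ : S(𝔤₁^*[p])^{(1)} → H^•(𝔤, k)` induced by the `p`-power map. -/
def phi : L.OddFunctions →+* L.Cohomology :=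
  L.toCohomology.comp ((L.powMap p).codRestrict L.cocycles (L.powMap_mem_cocycles p))

/-- The ideal `J_𝔤(k) = φ⁻¹(I_𝔤(k, k))`, where `I_𝔤(k, k)` is the annihilator of the (left)
cup product action of `H^•(𝔤, k)` on `Ext_𝔤^•(k, k) = H^•(𝔤, k)`. -/
def annihilatorIdeal : Ideal L.OddFunctions :=
  (Module.annihilator L.Cohomology L.Cohomology).comap (L.phi p)

/-- The variety `𝒳_𝔤(k) = Max(S(𝔤₁^*[p])^{(1)} / J_𝔤(k))`. -/
abbrev SupportVariety := MaximalSpectrum (L.OddFunctions ⧸ L.annihilatorIdeal p)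

end Power

end LieSuperalgebra

/-! ### Points of `𝔤₁` and the odd self-commuting cone -/

section Zariski

variable {k : Type u} {V : Type v} [Field k] [AddCommGroup V] [Module k V]

/-- Evaluation of polynomial functions, i.e. elements of `S(V^*)`, at a point of `V`. -/
def evalAt (x : V) : SymmetricAlgebra k (Dual k V) →ₐ[k] k :=
  SymmetricAlgebra.lift (Dual.eval k V x)

variable (k V)

/-- The Zariski topology on a finite-dimensional vector space: the closed sets are the common zero
loci of sets of polynomial functions. -/
@[reducible] def zariskiTopology : TopologicalSpace V :=
  TopologicalSpace.ofClosed
    {Z | ∃ s : Set (SymmetricAlgebra k (Dual k V)), Z = {x | ∀ q ∈ s, evalAt x q = 0}}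
    ⟨{1}, by ext x; simp⟩
    (by
      intro A hA
      refine ⟨{q | ∃ Z ∈ A, ∀ x ∈ Z, evalAt x q = 0}, ?_⟩
      ext x
      constructor
      · rintro hx q ⟨Z, hZ, hq⟩
        exact hq x (hx Z hZ)
      · intro hx Z hZ
        obtain ⟨s, rfl⟩ := hA hZ
        exact fun q hq => hx q ⟨_, hZ, fun y hy => hy q hq⟩)
    (by
      rintro _ ⟨s, rfl⟩ _ ⟨t, rfl⟩
      refine ⟨{q | ∃ a ∈ s, ∃ b ∈ t, q = a * b}, ?_⟩
      ext x
      constructor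
      · rintro (hx | hx) _ ⟨a, ha, b, hb, rfl⟩
        · rw [map_mul, hx a ha, zero_mul]
        · rw [map_mul, hx b hb, mul_zero]
      · intro hx
        by_contra hcon
        simp only [Set.mem_union, not_or] at hcon
        obtain ⟨h1, h2⟩ := hcon
        change ¬ (∀ q ∈ s, evalAt x q = 0) at h1
        change ¬ (∀ q ∈ t, evalAt x q = 0) at h2
        push Not at h1 h2
        obtain ⟨a, ha, ha0⟩ := h1
        obtain ⟨b, hb, hb0⟩ := h2
        have h := hx (a * b) ⟨a, ha, b, hb, rfl⟩
        rw [map_mul] at h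
        exact (mul_ne_zero ha0 hb0) h)

end Zariski

namespace LieSuperalgebra

variable {k : Type u} {𝔤 : Type v} [Field k] [AddCommGroup 𝔤] [Module k 𝔤]
  {𝒢 : ZMod 2 → Submodule k 𝔤} [DirectSum.Decomposition 𝒢] (L : LieSuperalgebra k 𝒢)

/-- The odd self-commuting cone `{x ∈ 𝔤₁ : [x, x] = 0}`. -/
def OddCone := {x : 𝒢 1 // L.bracket (x : 𝔤) (x : 𝔤) = 0}

/-- The odd self-commuting cone carries the subspace topology of the Zariski topology on `𝔤₁`. -/
instance topologicalSpaceOddCone : TopologicalSpace L.OddCone :=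
  TopologicalSpace.induced Subtype.val (zariskiTopology k (𝒢 1))

/-- The maximal ideal of `S(𝔤₁^*)` of all functions vanishing at the point `x`. -/
def pointIdeal (x : 𝒢 1) : Ideal L.OddFunctions := RingHom.ker (evalAt (k := k) x)

/-- The ideal of `S(𝔤₁^*)` of all functions vanishing on the odd self-commuting cone. -/
def coneIdeal : Ideal L.OddFunctions := ⨅ x : L.OddCone, L.pointIdeal x.1

end LieSuperalgebra

end

/-! Write `N` for the left ideal of cochains generated by `𝔤₀^*`. Since `2` is invertible, even
generators square to zero, and they commute with everything up to sign; so `N` is two-sided and its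
elements are nilpotent, and every cochain is congruent mod `N` to the image of some `q` in
`S(𝔤₁^*)`. If a cocycle `z` is congruent to `q`, then `z^p` is congruent to `q^p`, which is itself a
cocycle representing `φ(q)`. Hence `[z]^p - φ(q)` is nilpotent (`isNilpotent_pow_sub_phi`): modulo
nilpotents every `p`-th power lies in the image of `φ`. A ring map with this property is integral
and induces a homeomorphism from `Max` of its target onto the zero locus of its kernel
(`exists_homeomorph_maximalSpectrum`).

It remains to find the zero locus. The relations of `Λ_s(𝔤^*)` hold after evaluation at an odd point
`x`, and `∂f` takes the value `-(1/2) f([x, x])` there. If `[x, x] = 0`, evaluation kills all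
coboundaries, so nilpotency of `φ(q)` forces `q(x) = 0` (`evalAt_of_isNilpotent_phi`). If `[x, x] ≠
0`, some `∂f` is nonzero at `x`; being a coboundary, it yields a `q` with `φ(q)` nilpotent and `q(x)
≠ 0` (`exists_isNilpotent_phi_of_bracket_ne_zero`). So the zero locus is the cone.

As `H^•(𝔤, k)` has a unit, its annihilator vanishes and `J` is the kernel of `φ`. Passing to the
quotient by `Nil` does not change the zero locus, so the same cone serves both varieties, and the
radical of `J` follows from the Nullstellensatz. -/

section Nullstellensatz

/-! ### The Nullstellensatz and power-surjective ring maps -/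

variable {k : Type*} {V : Type*} [Field k] [AddCommGroup V] [Module k V]

@[simp]
theorem evalAt_ι (x : V) (f : Dual k V) : evalAt x (SymmetricAlgebra.ι k _ f) = f x := by
  simp [evalAt]

theorem ker_evalAt_isMaximal (x : V) :
    (RingHom.ker (evalAt (k := k) x)).IsMaximal :=
  RingHom.ker_isMaximal_of_surjective _ fun c => ⟨algebraMap k _ c, by simp⟩

theorem isClosed_zariskiTopology_iff {Z : Set V} :
    @IsClosed V (zariskiTopology k V) Z ↔
      ∃ s : Set (SymmetricAlgebra k (Dual k V)), Z = {x | ∀ q ∈ s, evalAt x q = 0} := by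
  rw [← @isOpen_compl_iff _ _ (zariskiTopology k V)]
  change Zᶜᶜ ∈ _ ↔ _
  rw [compl_compl]
  rfl

variable [FiniteDimensional k V]

theorem finiteType_symmetricAlgebra_dual :
    Algebra.FiniteType k (SymmetricAlgebra k (Dual k V)) :=
  Algebra.FiniteType.equiv inferInstance
    (SymmetricAlgebra.equivMvPolynomial (finBasis k (Dual k V))).symm

/-- The weak Nullstellensatz for polynomial functions on a finite-dimensional vector space. -/
theorem exists_eq_ker_evalAt [IsAlgClosed k] (M : Ideal (SymmetricAlgebra k (Dual k V)))
    [M.IsMaximal] : ∃ x : V, M = RingHom.ker (evalAt (k := k) x) := by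
  have := finiteType_symmetricAlgebra_dual (k := k) (V := V)
  let := Ideal.Quotient.field M
  -- Zariski's lemma: the residue field is finite over `k`, hence equal to `k`, so `M` is the kernel
  -- of a character `F`.
  have := finite_of_finite_type_of_isJacobsonRing k (SymmetricAlgebra k (Dual k V) ⧸ M)
  let e := AlgEquiv.ofBijective (Algebra.ofId k (SymmetricAlgebra k (Dual k V) ⧸ M))
    IsAlgClosed.algebraMap_bijective_of_isIntegral
  let F : SymmetricAlgebra k (Dual k V) →ₐ[k] k :=
    e.symm.toAlgHom.comp (Ideal.Quotient.mkₐ k M)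
  -- A character is determined by its restriction to `V^*`, an element of the bidual, which comes
  -- from a point because `V` is finite-dimensional.
  let x : V := (evalEquiv k V).symm (F.toLinearMap ∘ₗ SymmetricAlgebra.ι k _)
  have hx : evalAt x = F := by
    refine SymmetricAlgebra.algHom_ext (LinearMap.ext fun f => ?_)
    change evalAt x (SymmetricAlgebra.ι k _ f) = _
    rw [evalAt_ι, apply_evalEquiv_symm_apply]
    rfl
  refine ⟨x, ?_⟩
  ext q
  rw [hx, RingHom.mem_ker]
  change _ ↔ e.symm (Ideal.Quotient.mk M q) = 0
  rw [EmbeddingLike.map_eq_zero_iff, Ideal.Quotient.eq_zero_iff_mem]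

/-- Linear functions separate points: `f - f(x)` vanishes at `x`, and if it also vanishes at `y` for
every `f`, then `x = y`. -/
theorem ker_evalAt_injective :
    Function.Injective fun x : V => RingHom.ker (evalAt (k := k) x) := by
  intro x y h
  refine (forall_dual_apply_eq_zero_iff k (x - y)).1 (fun f => ?_) |> sub_eq_zero.1
  have hf : SymmetricAlgebra.ι k _ f - algebraMap k _ (f x) ∈ RingHom.ker (evalAt (k := k) x) := by
    simp [RingHom.mem_ker]
  rw [show RingHom.ker (evalAt (k := k) x) = RingHom.ker (evalAt (k := k) y) from h,
    RingHom.mem_ker] at hf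
  rw [map_sub, ← neg_sub, neg_eq_zero]
  simpa using hf

/-- Hilbert's Nullstellensatz for polynomial functions on a finite-dimensional vector space. -/
theorem radical_eq_iInf_ker_evalAt [IsAlgClosed k] (J : Ideal (SymmetricAlgebra k (Dual k V))) :
    J.radical = ⨅ (x : V) (_ : J ≤ RingHom.ker (evalAt (k := k) x)),
      RingHom.ker (evalAt (k := k) x) := by
  have := finiteType_symmetricAlgebra_dual (k := k) (V := V)
  have : IsJacobsonRing (SymmetricAlgebra k (Dual k V)) := isJacobsonRing_of_finiteType (A := k)
  -- In a Jacobson ring the radical is an intersection of maximal ideals, and these are the point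
  -- ideals.
  rw [Ideal.radical_eq_jacobson]
  refine le_antisymm (le_iInf₂ fun x hx => sInf_le ⟨hx, ker_evalAt_isMaximal x⟩)
    (le_sInf fun M ⟨hJ, hM⟩ => ?_)
  obtain ⟨x, rfl⟩ := exists_eq_ker_evalAt M
  exact iInf₂_le x hJ

/-- Let `g : k[V] → R` be a ring homomorphism whose image contains a power of every element of `R`.
Then `Max R` is homeomorphic to the zero locus of the kernel of `g`. -/
theorem exists_homeomorph_maximalSpectrum [IsAlgClosed k] {R : Type*} [CommRing R]
    (g : SymmetricAlgebra k (Dual k V) →+* R) (hg : ∀ h, ∃ n ≠ 0, ∃ q, h ^ n = g q)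
    {X : Type*} [t : TopologicalSpace X] (i : X → V) (hi : Function.Injective i)
    (ht : t = (zariskiTopology k V).induced i)
    (hX : ∀ x, x ∈ Set.range i ↔ RingHom.ker g ≤ RingHom.ker (evalAt (k := k) x)) :
    ∃ Φ : X ≃ₜ MaximalSpectrum R, ∀ x,
      (Φ x).asIdeal.comap g = RingHom.ker (evalAt (k := k) (i x)) := by
  -- Each `h` is a root of `X^n - q`, which is monic because `n ≠ 0`. Integrality supplies
  -- lying-over, and the maximality of contractions.
  have hint : g.IsIntegral := by
    intro h
    obtain ⟨n, hn, q, hq⟩ := hg h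
    refine ⟨Polynomial.X ^ n - Polynomial.C q, Polynomial.monic_X_pow_sub_C q hn, ?_⟩
    simp [hq]
  algebraize [g]
  have hex : ∀ x : X, ∃ M : MaximalSpectrum R,
      M.asIdeal.comap g = RingHom.ker (evalAt (k := k) (i x)) := by
    intro x
    have := ker_evalAt_isMaximal (k := k) (i x)
    obtain ⟨Q, hQ, h⟩ := Ideal.exists_ideal_over_maximal_of_isIntegral (S := R)
      (RingHom.ker (evalAt (k := k) (i x))) ((hX _).1 ⟨x, rfl⟩)
    exact ⟨⟨Q, hQ⟩, h⟩
  choose Φ hΦ using hex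
  -- A maximal ideal of `R` is recovered from its contraction: `h` lies in it exactly when `g q = h
  -- ^ n` does. This makes the lying-over ideal unique and carries closed sets across.
  have hmem : ∀ (M : MaximalSpectrum R) {h n q}, n ≠ 0 → h ^ n = g q →
      (h ∈ M.asIdeal ↔ q ∈ M.asIdeal.comap g) := by
    intro M h n q hn hq
    rw [Ideal.mem_comap, ← hq, M.isMaximal.isPrime.pow_mem_iff_mem n (Nat.pos_of_ne_zero hn)]
  have hinj : Function.Injective Φ := by
    intro x y hxy
    refine hi (ker_evalAt_injective (k := k) ?_)
    change RingHom.ker _ = RingHom.ker _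
    rw [← hΦ, ← hΦ, hxy]
  have hsurj : Function.Surjective Φ := by
    intro M
    have := M.isMaximal
    have := Ideal.isMaximal_comap_of_isIntegral_of_isMaximal' g hint M.asIdeal
    obtain ⟨v, hv⟩ := exists_eq_ker_evalAt (M.asIdeal.comap g)
    -- The contraction contains the kernel, which is the contraction of `⊥`, so the point `v`
    -- belongs to the zero locus.
    obtain ⟨x, rfl⟩ := (hX v).2 (hv ▸ Ideal.comap_mono bot_le)
    refine ⟨x, MaximalSpectrum.ext (Ideal.ext fun h => ?_)⟩
    obtain ⟨n, hn, q, hq⟩ := hg h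
    rw [hmem _ hn hq, hmem _ hn hq, hΦ, hv]
  refine ⟨(Equiv.ofBijective Φ ⟨hinj, hsurj⟩).toHomeomorphOfIsInducing ⟨?_⟩, hΦ⟩
  refine TopologicalSpace.ext_iff_isClosed.2 fun Z => ?_
  rw [ht, @isClosed_induced_iff _ _ (zariskiTopology k V), isClosed_induced_iff]
  constructor
  · rintro ⟨_, hW, rfl⟩
    obtain ⟨s, rfl⟩ := isClosed_zariskiTopology_iff.1 hW
    -- Equations `s` on `V` become the equations `g '' s` on `Max R`.
    refine ⟨_, isClosed_induced_iff.2 ⟨_, PrimeSpectrum.isClosed_zeroLocus (g '' s), rfl⟩, ?_⟩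
    ext x
    change g '' s ⊆ ((Φ x).asIdeal : Set R) ↔ ∀ q ∈ s, q ∈ RingHom.ker (evalAt (k := k) (i x))
    rw [Set.image_subset_iff, ← hΦ]
    rfl
  · rintro ⟨_, hW, rfl⟩
    obtain ⟨_, hW', rfl⟩ := isClosed_induced_iff.1 hW
    obtain ⟨s, rfl⟩ := (PrimeSpectrum.isClosed_iff_zeroLocus _).1 hW'
    -- Conversely, an equation `h` on `Max R` is replaced by the polynomial `q h` for which `g (q
    -- h)` is a power of `h`; the zero locus is the same.
    choose n hn q hq using hg
    refine ⟨_, isClosed_zariskiTopology_iff.2 ⟨q '' s, rfl⟩, ?_⟩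
    ext x
    change (∀ r ∈ q '' s, r ∈ RingHom.ker (evalAt (k := k) (i x))) ↔ ∀ h ∈ s, h ∈ (Φ x).asIdeal
    rw [Set.forall_mem_image, ← hΦ]
    exact forall₂_congr fun h _ => (hmem _ (hn h) (hq h)).symm

end Nullstellensatz

/-! ### Evaluation of cochains at odd points -/

namespace LieSuperalgebra

variable {k : Type*} {𝔤 : Type*} [Field k] [AddCommGroup 𝔤] [Module k 𝔤]
  {𝒢 : ZMod 2 → Submodule k 𝔤} [DirectSum.Decomposition 𝒢] (L : LieSuperalgebra k 𝒢)

/-- The evaluation of cochains at an odd point, `Λ_s(𝔤^*) → S(𝔤₁^*) → k`. -/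
noncomputable def cochainEval (x : 𝒢 1) : L.Cochains →ₐ[k] k :=
  SuperExterior.lift (Dual.eval k 𝔤 x) (by
    intro i j f g hf hg
    have h : ∀ i : ZMod 2, i = 1 ∨ 1 ≠ i := by decide
    simp only [Dual.eval_apply]
    -- An even functional vanishes at `x`. For two odd ones the two signs cancel, and the relation
    -- is commutativity of `k`.
    rcases h i with rfl | hi
    · rcases h j with rfl | hj
      · simp [superSign, mul_comm]
      · simp [hg 1 hj x x.2]
    · simp [hf 1 hi x x.2])

@[simp]
theorem cochainEval_gen (x : 𝒢 1) (f : Dual k 𝔤) :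
    L.cochainEval x (SuperExterior.gen _ f) = f x := by
  simp [cochainEval]

variable [FiniteDimensional k 𝔤]

theorem cochainEval_symIncl (x : 𝒢 1) (q : L.OddFunctions) :
    L.cochainEval x (L.symIncl q) = evalAt x q := by
  have h : (L.cochainEval x).comp L.symIncl = evalAt x := by
    refine SymmetricAlgebra.algHom_ext (LinearMap.ext fun f => ?_)
    change L.cochainEval x (L.symIncl (SymmetricAlgebra.ι k _ f)) =
      evalAt x (SymmetricAlgebra.ι k _ f)
    rw [symIncl_ι, evalAt_ι, oddGen, LinearMap.comp_apply, cochainEval_gen]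
    change f (superProj 𝒢 1 x) = f x
    exact congrArg f (Subtype.ext (superEndo_of_mem 𝒢 x.2))
  exact DFunLike.congr_fun h q

theorem cochainEval_of_mem_span (x : 𝒢 1) {a : L.Cochains}
    (ha : a ∈ Ideal.span (SuperExterior.gen (dualPart 𝒢) '' (dualPart 𝒢 0 : Set (Dual k 𝔤)))) :
    L.cochainEval x a = 0 := by
  have h : Ideal.span (SuperExterior.gen (dualPart 𝒢) '' (dualPart 𝒢 0 : Set (Dual k 𝔤))) ≤
      RingHom.ker (L.cochainEval x) := by
    refine Ideal.span_le.2 ?_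
    rintro _ ⟨f, hf, rfl⟩
    exact (L.cochainEval_gen x f).trans (hf 1 (by decide) x x.2)
  exact h ha

/-- Evaluating a product of two generators at `x` is evaluating the corresponding bilinear form at
`x ⊗ x`. This undoes the inverse of `dualDistribEquiv` in `dGen` and leaves the bracket form on the
diagonal. -/
theorem cochainEval_dGen (x : 𝒢 1) (f : Dual k 𝔤) :
    L.cochainEval x (L.dGen f) = -(2 : k)⁻¹ * f (L.bracket x x) := by
  have h : ∀ t : Dual k 𝔤 ⊗[k] Dual k 𝔤, L.cochainEval x (L.mulGen t) =
      TensorProduct.dualDistribEquiv k 𝔤 𝔤 t ((x : 𝔤) ⊗ₜ[k] (x : 𝔤)) := by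
    intro t
    induction t using TensorProduct.induction_on with
    | zero => simp
    | add s t hs ht => simp [hs, ht]
    | tmul u w => simp [TensorProduct.dualDistribEquiv, TensorProduct.dualDistribEquivOfBasis]
  simp only [dGen, LinearMap.smul_apply, LinearMap.comp_apply, map_smul, h, LinearEquiv.coe_coe,
    LinearEquiv.apply_symm_apply, smul_eq_mul]
  simp [bracketForm]

/-- Evaluation is multiplicative, so the Leibniz rule reduces the claim to generators, where
`cochainEval_dGen` applies. Thus points of the cone define characters of the cohomology ring. -/
theorem cochainEval_d {x : 𝒢 1} (hx : L.bracket x x = 0) (a : L.Cochains) :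
    L.cochainEval x (L.d a) = 0 := by
  induction a using SuperExterior.induction with
  | scalar c => rw [d_algebraMap, map_zero]
  | gen f => rw [d_gen, cochainEval_dGen, hx, map_zero, mul_zero]
  | mul a b ha hb => rw [d_mul, map_add, map_mul, map_mul, ha, hb, zero_mul, mul_zero, add_zero]
  | sum a b ha hb => rw [map_add, map_add, ha, hb, add_zero]

/-- Powers of cochains which agree modulo the ideal generated by `𝔤₀^*` also agree. -/
theorem pow_sub_pow_mem_span {a b : L.Cochains} (h : a - b ∈
      Ideal.span (SuperExterior.gen (dualPart 𝒢) '' (dualPart 𝒢 0 : Set (Dual k 𝔤)))) (n : ℕ) :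
    a ^ n - b ^ n ∈
      Ideal.span (SuperExterior.gen (dualPart 𝒢) '' (dualPart 𝒢 0 : Set (Dual k 𝔤))) := by
  induction n with
  | zero => simp
  | succ n ih =>
    -- Cochains do not commute, so the split keeps the order of factors; its first term needs the
    -- ideal to be stable under right multiplication.
    have h1 : a ^ (n + 1) - b ^ (n + 1) = (a ^ n - b ^ n) * a + b ^ n * (a - b) := by
      rw [pow_succ, pow_succ]
      noncomm_ring
    rw [h1]
    exact Ideal.add_mem _ (span_even_mul L (fun _ h => h) ih _) (Ideal.mul_mem_left _ _ h)

/-! ### The map `φ` modulo nilpotents and its zero locus -/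

variable (p : ℕ) [Fact p.Prime] [CharP k p]

/-- The image of `q` need not be a cocycle, but its `p`-th power is. The difference of `p`-th powers
is therefore a cocycle lying in a nil ideal of cochains, and its vanishing power descends to
cohomology. -/
theorem isNilpotent_pow_sub_phi (hk : (2 : k) ≠ 0) (z : L.cocycles) {q : L.OddFunctions}
    (hq : (z : L.Cochains) - L.symIncl q ∈
      Ideal.span (SuperExterior.gen (dualPart 𝒢) '' (dualPart 𝒢 0 : Set (Dual k 𝔤)))) :
    IsNilpotent (L.toCohomology z ^ p - L.phi p q) := by
  obtain ⟨n, hn⟩ := L.isNilpotent_of_mem_evenIdeal hk (L.pow_sub_pow_mem_span hq p)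
  let y : L.cocycles := ⟨L.powMap p q, L.powMap_mem_cocycles p q⟩
  have h : (z ^ p - y) ^ n = 0 := Subtype.ext (by
    simpa [y, powMap_apply] using hn)
  have hy : L.toCohomology z ^ p - L.phi p q = L.toCohomology (z ^ p - y) := by
    rw [map_sub, map_pow]
    rfl
  exact ⟨n, by rw [hy, ← map_pow, h, map_zero]⟩

/-- Acting on the class `1` shows that only zero annihilates the unital ring `H^•(𝔤, k)`, so `J` is
the kernel of `φ`. -/
theorem mem_annihilatorIdeal {q : L.OddFunctions} :
    q ∈ L.annihilatorIdeal p ↔ L.phi p q = 0 := by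
  rw [annihilatorIdeal, Ideal.mem_comap, Module.mem_annihilator]
  exact ⟨fun h => by simpa using h 1, fun h m => by rw [h, zero_smul]⟩

/-- If `φ(q)^n = 0`, then the image of `q^(np)` is a coboundary, which evaluates to zero at a point
of the cone; the field `k` has no nilpotents. -/
theorem evalAt_of_isNilpotent_phi {x : 𝒢 1} (hx : L.bracket x x = 0) {q : L.OddFunctions}
    (hq : IsNilpotent (L.phi p q)) : evalAt x q = 0 := by
  obtain ⟨n, hn⟩ := hq
  rw [← map_pow] at hn
  obtain ⟨a, ha⟩ := Ideal.Quotient.eq_zero_iff_mem.1 hn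
  have h := L.cochainEval_d hx a
  rw [ha] at h
  change L.cochainEval x (L.powMap p (q ^ n)) = 0 at h
  rw [powMap_apply, map_pow, cochainEval_symIncl, map_pow] at h
  exact eq_zero_of_pow_eq_zero (eq_zero_of_pow_eq_zero h)

/-- The witness `q` is the part of `∂f` in `S(𝔤₁^*)`, essentially the quadratic form `-(1/2) f([x,
x])`. Since `∂f` has zero class, `isNilpotent_pow_sub_phi` makes `φ(q)` nilpotent. -/
theorem exists_isNilpotent_phi_of_bracket_ne_zero (hk : (2 : k) ≠ 0) {x : 𝒢 1}
    (hx : L.bracket x x ≠ 0) : ∃ q, IsNilpotent (L.phi p q) ∧ evalAt x q ≠ 0 := by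
  obtain ⟨f, hf⟩ : ∃ f : Dual k 𝔤, f (L.bracket x x) ≠ 0 := by
    by_contra! h
    exact hx ((forall_dual_apply_eq_zero_iff k _).1 h)
  obtain ⟨q, hq⟩ := L.exists_symIncl_sub_mem (L.dGen f)
  refine ⟨q, ?_, ?_⟩
  · have h := L.isNilpotent_pow_sub_phi p hk ⟨L.dGen f, L.d_dGen f⟩ hq
    have h0 : L.toCohomology ⟨L.dGen f, L.d_dGen f⟩ = 0 :=
      Ideal.Quotient.eq_zero_iff_mem.2 ⟨SuperExterior.gen _ f, L.d_gen f⟩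
    rwa [h0, zero_pow (Fact.out : p.Prime).ne_zero, zero_sub, isNilpotent_neg_iff] at h
  · have h := L.cochainEval_of_mem_span x hq
    rw [map_sub, cochainEval_dGen, cochainEval_symIncl, sub_eq_zero] at h
    rw [← h]
    exact mul_ne_zero (neg_ne_zero.2 (inv_ne_zero hk)) hf

theorem toReduced_eq_zero_iff {h : L.Cohomology} : L.toReduced h = 0 ↔ IsNilpotent h :=
  Ideal.Quotient.eq_zero_iff_mem

theorem bracket_self_eq_zero_iff_ker_toReduced (hk : (2 : k) ≠ 0) (x : 𝒢 1) :
    L.bracket x x = 0 ↔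
      RingHom.ker (L.toReduced.comp (L.phi p)) ≤ RingHom.ker (evalAt (k := k) x) := by
  refine ⟨fun hx q hq => L.evalAt_of_isNilpotent_phi p hx (L.toReduced_eq_zero_iff.1 hq),
    fun h => ?_⟩
  by_contra hx
  obtain ⟨q, hq, hqx⟩ := L.exists_isNilpotent_phi_of_bracket_ne_zero p hk hx
  exact hqx (h (L.toReduced_eq_zero_iff.2 hq))

theorem bracket_self_eq_zero_iff_annihilatorIdeal_le (hk : (2 : k) ≠ 0) (x : 𝒢 1) :
    L.bracket x x = 0 ↔ L.annihilatorIdeal p ≤ RingHom.ker (evalAt (k := k) x) := by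
  refine ⟨fun hx q hq => L.evalAt_of_isNilpotent_phi p hx
    (by rw [(L.mem_annihilatorIdeal p).1 hq]; exact IsNilpotent.zero), fun h => ?_⟩
  by_contra hx
  obtain ⟨q, ⟨n, hn⟩, hqx⟩ := L.exists_isNilpotent_phi_of_bracket_ne_zero p hk hx
  -- Only a power of `q` lies in `J`, which is enough because evaluation takes values in a field.
  have hq : q ^ n ∈ L.annihilatorIdeal p := by rw [mem_annihilatorIdeal, map_pow, hn]
  exact hqx (eq_zero_of_pow_eq_zero ((map_pow _ _ _).symm.trans (h hq)))

/-- This is the power-surjectivity required by `exists_homeomorph_maximalSpectrum`, with the uniform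
exponent `p`. -/
theorem exists_pow_eq_toReduced_phi (hk : (2 : k) ≠ 0) (h : L.ReducedCohomology) :
    ∃ q, h ^ p = L.toReduced.comp (L.phi p) q := by
  obtain ⟨h, rfl⟩ := Ideal.Quotient.mk_surjective (I := L.nilIdeal) h
  obtain ⟨z, rfl⟩ := L.toCohomology_surjective h
  obtain ⟨q, hq⟩ := L.exists_symIncl_sub_mem (z : L.Cochains)
  refine ⟨q, ?_⟩
  have hn := L.toReduced_eq_zero_iff.2 (L.isNilpotent_pow_sub_phi p hk z hq)
  rw [map_sub, map_pow, sub_eq_zero] at hn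
  exact hn

theorem mem_range_oddCone_iff (x : 𝒢 1) :
    x ∈ Set.range (Subtype.val : L.OddCone → 𝒢 1) ↔ L.bracket x x = 0 :=
  ⟨by rintro ⟨y, rfl⟩; exact y.2, fun h => ⟨⟨x, h⟩, rfl⟩⟩

end LieSuperalgebra

/-! ### The main theorem -/

theorem mainTheorem4 {k : Type*} {𝔤 : Type*} [Field k] [IsAlgClosed k]
    (p : ℕ) [Fact p.Prime] [CharP k p] (hp : 3 ≤ p)
    [AddCommGroup 𝔤] [Module k 𝔤] [FiniteDimensional k 𝔤]
    (𝒢 : ZMod 2 → Submodule k 𝔤) [DirectSum.Decomposition 𝒢] (L : LieSuperalgebra k 𝒢) :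
    (∃ Φ : L.OddCone ≃ₜ L.SupportVariety p, ∀ x : L.OddCone,
      (Φ x).asIdeal.comap (Ideal.Quotient.mk (L.annihilatorIdeal p)) = L.pointIdeal x.1) ∧
    (L.annihilatorIdeal p).radical = L.coneIdeal ∧
    (∃ Ψ : L.OddCone ≃ₜ L.CohomologyVariety, ∀ x : L.OddCone,
      (Ψ x).asIdeal.comap (L.toReduced.comp (L.phi p)) = L.pointIdeal x.1) := by
  have hk : (2 : k) ≠ 0 := by
    have h : ((2 : ℕ) : k) ≠ 0 := by
      rw [Ne, CharP.cast_eq_zero_iff k p]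
      exact Nat.not_dvd_of_pos_of_lt two_pos hp
    exact_mod_cast h
  refine ⟨?_, ?_, ?_⟩
  · refine exists_homeomorph_maximalSpectrum (Ideal.Quotient.mk (L.annihilatorIdeal p))
      (fun h => ?_) _ Subtype.val_injective rfl fun x => ?_
    · obtain ⟨q, rfl⟩ := Ideal.Quotient.mk_surjective h
      -- A quotient map is surjective, so exponent `1` suffices.
      exact ⟨1, one_ne_zero, q, pow_one _⟩
    · rw [Ideal.mk_ker]
      exact (L.mem_range_oddCone_iff x).trans (L.bracket_self_eq_zero_iff_annihilatorIdeal_le p hk x)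
  -- Both sides are intersections of point ideals, over the zero locus of `J` and over the cone, and
  -- these index sets agree.
  · rw [radical_eq_iInf_ker_evalAt]
    refine le_antisymm (le_iInf fun x => iInf₂_le x.1
      ((L.bracket_self_eq_zero_iff_annihilatorIdeal_le p hk x.1).1 x.2)) (le_iInf₂ fun x hx => ?_)
    exact iInf_le (fun x : L.OddCone => L.pointIdeal x.1)
      ⟨x, (L.bracket_self_eq_zero_iff_annihilatorIdeal_le p hk x).2 hx⟩
  · refine exists_homeomorph_maximalSpectrum (L.toReduced.comp (L.phi p))
      (fun h => ⟨p, (Fact.out : p.Prime).ne_zero, L.exists_pow_eq_toReduced_phi p hk h⟩)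
      _ Subtype.val_injective rfl fun x => ?_
    exact (L.mem_range_oddCone_iff x).trans (L.bracket_self_eq_zero_iff_ker_toReduced p hk x)
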